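/- Let $F$ be a non-archimedean local field, $\mathcal O$ its ring of integers, $\pi$ a uniformizer of $\mathcal O$ and $K=SL_3(\mathcal O)$. For a finite abelian group $A$ with dual group $\hat A$ and a Banach space $E$, let $T_A\otimes 1_E:\ell^2(A,E)\to\ell^2(\hat A,E)$ be the operator $f\mapsto\big[\chi\mapsto \frac1{\#A}\sum_{x\in A}\chi(x)f(x)\big]$, where for a finite set $I$ the norm of $\ell^2(I,E)$ is $\|f\|=\big(\frac1{\#I}\sum_{x\in I}\|f(x)\|_E^2\big)^{1/2}$. Let $h\ge 1$ be an integer, $\alpha>0$, and let $\mathcal E$ be a class of complex Banach spaces such that $\|T_{\mathcal O/\pi^h\mathcal O}\otimes 1_E\|\le e^{-\alpha}$ for every $E\in\mathcal E$. Let $G'=\{g\in GL_3(F):\det g\in\pi^{\mathbb Z}\}/(\pi^{\mathbb Z}\,\mathrm{Id})$, which contains $K$, and for $i,j\in\mathbb N$ let $D(i,j)\in G'$ be the class of $\mathrm{diag}(\pi^{-(i+j)},\pi^{-j},1)$. Every element of $G'$ has the form $kD(i,j)k'$ with $k,k'\in K$ and unique $i,j\in\mathbb N$; put $\ell(kD(i,j)k')=i+j$.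 For $C,\beta\ge 0$ let $\mathcal E_{G',C+\beta\ell}$ be the class of (strongly) continuous representations $(E,\pi)$ of $G'$ on Banach spaces $E\in\mathcal E$ with $\|\pi(g)\|\le e^{C+\beta\ell(g)}$ for all $g\in G'$. Let $\Lambda=\{(i,j)\in\mathbb N^2: i-j\in 3\mathbb Z\}$. **Proposition 4.6.** Let $\beta\in[0,\frac{\alpha}{3h})$ and let $(V,\tau)$ be a nontrivial continuous irreducible unitary representation of $K$ (so that $V$ is finite-dimensional). There exists $C'>0$ such that the following holds for every real $C\ge 0$, every $(E,\pi)\in\mathcal E_{G',C+\beta\ell}$, every $K$-invariant vector $\xi\in E$ of norm $1$ and every $K$-invariant vector $\eta\in V\otimes E^*$ of norm $1$, where $K$ acts on $V\otimes E^*$ by $k\mapsto\tau(k)\otimes{}^t\pi(k^{-1})$, and $V\otimes E^*$ is normed as the space of bounded operators from $E$ to $V$. Put $c(i,j)=\langle\eta,\pi(D(i,j))\xi\rangle\in V$, where $\langle v\otimes\varphi,x\rangle=\varphi(x)v$. Then the restriction of $c$ to $\Lambda$ tends to $0$ at infinity, and $$\|c(i,j)\|_V\le C'\,e^{2C-\left(\frac{\alpha}{3h}-\beta\right)(i+j)}\qquad\text{for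 all }(i,j)\in\Lambda.$$ -/

import Mathlib

open scoped TensorProduct Topology

noncomputable section

namespace LiaoSL3

/-! ### The operators `T_A ⊗ 1_E` for a finite abelian group `A` -/

section Fourier

/-- The average of a family of vectors indexed by a finite type. -/
def mean {ι E : Type*} [Finite ι] [AddCommGroup E] [Module ℝ E] (f : ι → E) : E :=
  (Nat.card ι : ℝ)⁻¹ • ∑ᶠ i, f i

/-- The norm of `ℓ²(ι, E)`, normalized by an average. -/
def ell2Norm {ι E : Type*} [Finite ι] [NormedAddCommGroup E] (f : ι → E) : ℝ :=
  √(mean fun i => ‖f i‖ ^ 2)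

variable {A E : Type*} [AddCommGroup A] [Finite A] [NormedAddCommGroup E] [NormedSpace ℂ E]

/-- `(T_A ⊗ 1_E) f (χ)` is the average over `x ∈ A` of `χ(x) f(x)`, for a character `χ` of `A`. -/
def fourier (f : A → E) (χ : AddChar A ℂ) : E :=
  mean fun x => χ x • f x

variable (A E) in
/-- The operator norm of `T_A ⊗ 1_E : ℓ²(A, E) → ℓ²(Â, E)` is at most `M`. -/
def FourierNormLE (M : ℝ) : Prop :=
  ∀ f : A → E, ell2Norm (fourier f) ≤ M * ell2Norm f

end Fourier

/-! ### The groups `K = SL₃(𝒪)` and `G' = {g ∈ GL₃(F) | det g ∈ ϖ^ℤ} / ϖ^ℤ` -/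

section Groups

open ValuativeRel

variable {F : Type*} [Field F]

/-- `ϖ` is a uniformizer of `F`: a nonzero element of `F` which is the image of an irreducible
element of the discrete valuation ring `𝒪[F]`. -/
def IsUniformizer [ValuativeRel F] (ϖ : Fˣ) : Prop :=
  ∃ p : 𝒪[F], Irreducible p ∧ (p : F) = ϖ

instance finite_quotient [ValuativeRel F] [TopologicalSpace F] [IsNonarchimedeanLocalField F]
    (h : ℕ) : Finite (𝒪[F] ⧸ 𝓂[F] ^ h) :=
  haveI : Finite (𝒪[F] ⧸ 𝓂[F]) := inferInstanceAs (Finite 𝓀[F])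
  Ideal.finite_quotient_pow (IsNoetherian.noetherian _) h

/-- The group of all `g ∈ GL₃(F)` whose determinant is an integral power of `ϖ`. -/
def detPow (ϖ : Fˣ) : Subgroup (GL (Fin 3) F) :=
  (Subgroup.zpowers ϖ).comap Matrix.GeneralLinearGroup.det

/-- The scalar matrix `ϖ · Id`, of determinant `ϖ ^ 3`. -/
def scalarPow (ϖ : Fˣ) : detPow ϖ :=
  ⟨Matrix.GeneralLinearGroup.scalar (Fin 3) ϖ, by
    simp [detPow, Subgroup.mem_comap, Matrix.GeneralLinearGroup.det_scalar]⟩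

instance scalarPow_normal (ϖ : Fˣ) : (Subgroup.zpowers (scalarPow ϖ)).Normal := by
  refine ⟨fun n hn g => ?_⟩
  have hc : ∀ g : detPow ϖ, Commute (scalarPow ϖ) g := fun g => Subtype.ext
    (Matrix.GeneralLinearGroup.scalar_commute ϖ (g : GL (Fin 3) F))
  obtain ⟨m, rfl⟩ := hn
  have : g * scalarPow ϖ ^ m * g⁻¹ = scalarPow ϖ ^ m := by
    rw [← ((hc g).zpow_left m).eq, mul_inv_cancel_right]
  exact ⟨m, this.symm⟩

/-- `G'`, with the quotient topology of the subspace topology of `GL₃(F)`. -/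
abbrev GPrime (ϖ : Fˣ) : Type _ := detPow ϖ ⧸ Subgroup.zpowers (scalarPow ϖ)

/-- The natural homomorphism (an embedding) of `K = SL₃(𝒪)` into `G'`. -/
def ofK [ValuativeRel F] (ϖ : Fˣ) :
    Matrix.SpecialLinearGroup (Fin 3) 𝒪[F] →* GPrime ϖ :=
  (QuotientGroup.mk' (Subgroup.zpowers (scalarPow ϖ))).comp
    ((Matrix.SpecialLinearGroup.mapGL F).codRestrict (detPow ϖ) fun k => by
      simp only [detPow, Subgroup.mem_comap, Matrix.SpecialLinearGroup.det_mapGL]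
      exact one_mem _)

/-- The diagonal matrix `diag(ϖ ^ (-(i+j)), ϖ ^ (-j), 1)`. -/
def diagMatrix (ϖ : Fˣ) (i j : ℕ) : Matrix (Fin 3) (Fin 3) F :=
  Matrix.diagonal ![(ϖ : F) ^ (-((i : ℤ) + j)), (ϖ : F) ^ (-(j : ℤ)), 1]

lemma det_diagMatrix (ϖ : Fˣ) (i j : ℕ) :
    (diagMatrix ϖ i j).det = ((ϖ ^ (-((i : ℤ) + j) + -(j : ℤ)) : Fˣ) : F) := by
  simp only [diagMatrix, Matrix.det_diagonal, Fin.prod_univ_three, Matrix.cons_val]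
  rw [zpow_add]
  push_cast
  ring

/-- The class in `G'` of the matrix `diag(ϖ ^ (-(i+j)), ϖ ^ (-j), 1)`. -/
def diagElt (ϖ : Fˣ) (i j : ℕ) : GPrime ϖ :=
  QuotientGroup.mk
    ⟨Matrix.GeneralLinearGroup.mkOfDetNeZero (diagMatrix ϖ i j)
        (by rw [det_diagMatrix]; exact Units.ne_zero _),
      Subgroup.mem_comap.mpr ⟨-((i : ℤ) + j) + -(j : ℤ), Units.ext (det_diagMatrix ϖ i j).symm⟩⟩

/-- The length on `G'`: `ℓ(k · diag(ϖ ^ (-(i+j)), ϖ ^ (-j), 1) · k') = i + j` for `k, k' ∈ K` and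
`i, j ∈ ℕ`. By the Cartan decomposition, the set below has exactly one element. -/
def length [ValuativeRel F] (ϖ : Fˣ) (g : GPrime ϖ) : ℕ :=
  sInf {n | ∃ (i j : ℕ) (k k' : Matrix.SpecialLinearGroup (Fin 3) 𝒪[F]),
    g = ofK ϖ k * diagElt ϖ i j * ofK ϖ k' ∧ n = i + j}

end Groups

/-! ### Representations -/

section Representations

/-- A strongly continuous representation of a topological group by bounded operators. -/
def IsContinuousRep {G E : Type*} [Group G] [TopologicalSpace G] [NormedAddCommGroup E]
    [NormedSpace ℂ E] (π : G →* (E →L[ℂ] E)) : Prop :=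
  ∀ x : E, Continuous fun g => π g x

/-- A continuous irreducible unitary representation: the space is nonzero and has no closed
invariant subspaces besides `0` and itself. -/
structure IsIrreducibleUnitaryRep {K V : Type*} [Group K] [TopologicalSpace K]
    [NormedAddCommGroup V] [InnerProductSpace ℂ V] (τ : K →* (V ≃ₗᵢ[ℂ] V)) : Prop where
  continuous : ∀ v : V, Continuous fun k => τ k v
  nontrivial : Nontrivial V
  irreducible : ∀ W : Submodule ℂ V, IsClosed (W : Set V) →
    (∀ k, ∀ w ∈ W, τ k w ∈ W) → W = ⊥ ∨ W = ⊤

variable {V E : Type*} [NormedAddCommGroup V] [InnerProductSpace ℂ V]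
  [NormedAddCommGroup E] [NormedSpace ℂ E]

/-- The canonical map from `V ⊗ E*` to bounded operators `E → V`, sending `v ⊗ φ` to
`x ↦ φ(x) v`. -/
def toOperator : V ⊗[ℂ] (StrongDual ℂ E) →ₗ[ℂ] (E →L[ℂ] V) :=
  TensorProduct.lift
    (LinearMap.mk₂ ℂ (fun (v : V) (φ : StrongDual ℂ E) => φ.smulRight v)
      (fun v w φ => by ext x; simp)
      (fun c v φ => by ext x; exact smul_comm _ _ _)
      (fun v φ ψ => by ext x; simp [add_smul])
      (fun c v φ => by ext x; exact mul_smul _ _ _))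

/-- The pairing `V ⊗ E* × E → V`, with `⟨v ⊗ φ, x⟩ = φ(x) v`. -/
def pairing (η : V ⊗[ℂ] (StrongDual ℂ E)) (x : E) : V := toOperator η x

/-- The norm of `V ⊗ E*` (for finite-dimensional `V`), as the space of bounded operators
`E → V`. This is the injective norm, the smallest of the reasonable cross norms. -/
def tensorNorm (η : V ⊗[ℂ] (StrongDual ℂ E)) : ℝ := ‖toOperator η‖

/-- The action of `k` on `V ⊗ E*`: the tensor product of `τ(k)` and of the contragredient
operator `ᵗρ(k⁻¹)` on `E*`. -/
def tensorAction {K : Type*} [Group K] (τ : K →* (V ≃ₗᵢ[ℂ] V)) (ρ : K →* (E →L[ℂ] E)) (k : K) :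
    V ⊗[ℂ] (StrongDual ℂ E) →ₗ[ℂ] V ⊗[ℂ] (StrongDual ℂ E) :=
  TensorProduct.map ((τ k).toLinearEquiv : V →ₗ[ℂ] V)
    (ContinuousLinearMap.precomp (σ := RingHom.id ℂ) (τ := RingHom.id ℂ) ℂ (ρ k⁻¹)).toLinearMap

end Representations

/-- The set `Λ` of all `(i, j) ∈ ℕ²` with `i - j ∈ 3ℤ`. -/
def Lam : Set (ℕ × ℕ) := {p | (3 : ℤ) ∣ (p.1 : ℤ) - (p.2 : ℤ)}

end LiaoSL3

end

universe u v w

open LiaoSL3 ValuativeRel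

noncomputable section

namespace LiaoSL3

/-! Write `H : E → V` for the operator given by `η`: it is `K`-equivariant of norm 1, and `c(i,j) =
H(π(D(i,j))ξ)`. The proof follows Lafforgue's strategy: `c` varies little along certain lines of
`Λ`, hence has a limit, and the limit is `K`-fixed, hence zero.

For `z` in `𝒪` let `k(z)` in `K` have corner entry `z`, and put `f(z) = H(π(D(i+j,0) k(z)
D(j,0))ξ)`. Then `f(0) = c(i,j)`. For `z = π^(j-t)` the matrix lies in `k' D(i+2t,j-t) K` with `k'`
congruent to 1 modulo `π^(i+t)`. Since `τ` is trivial on a congruence subgroup of some level `N`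
(`exists_congruenceSubgroup_trivial`), `f(π^(j-t)) = c(i+2t,j-t)` once `i+t ≥ N`.

Pairing a row `(-b,-a,1)` with a column `(1,x,y)` shows that, for `x` divisible by `π^N`,
`f(y-ax-b)` is an operator depending on `(a,b)` applied to a vector depending on `(x,y)`. A Fourier
transform in `y` turns this incidence relation into a kernel `ψ(ax)` on about `j` digits. As in the
fast Fourier transform, it splits into about `j/h` transforms of `𝒪/π^h`, each contracting by
`e^(-α)` (`fast_fourier`, `norm_sum_char_smul_le`). Up to a constant, `‖c(i,j) - c(i+2t,j-t)‖` is
thus at most `e^(2C + β(i+2j) - αj/h)`.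

On the line `i+2j = 3n` these bounds form a geometric series, dominated by its value at the
diagonal, `e^((3β-α/h)n)`. The automorphism `g ↦ J(g⁻¹)ᵀJ` gives the same on `2i+j = 3n`. Zigzagging
between the two families yields a limit `l`, approached at rate `e^(-(α/3h-β)(i+j))`
(`exists_limit`).

Along the walls, `D(0,m)` commutes with `SL₂ × 1` and `D(m,0)` with `1 × SL₂`; these blocks generate
`K`, so `l` is `K`-fixed. Irreducibility and nontriviality of `τ` force `l = 0`. -/

/-! ### Kernels acting on vector-valued functions -/

section Kernel

/-- The operator with kernel `κ` has squared norm at most `B` on (unnormalized) `ℓ²(Q, E)`. -/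
def KernelLE {Q : Type*} [Fintype Q] (κ : Q → Q → ℂ) (E : Type*) [NormedAddCommGroup E]
    [NormedSpace ℂ E] (B : ℝ) : Prop :=
  ∀ f : Q → E, ∑ a, ‖∑ x, κ a x • f x‖ ^ 2 ≤ B * ∑ x, ‖f x‖ ^ 2

/-- Squared `ℓ²` norms add over coordinates, so the bound can be summed over `Y`. It allows an
auxiliary translation variable to be carried along. -/
lemma KernelLE.piLp {Q Y : Type*} [Fintype Q] [Fintype Y] {κ : Q → Q → ℂ} {E : Type*}
    [NormedAddCommGroup E] [NormedSpace ℂ E] {B : ℝ} (hκ : KernelLE κ E B) :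
    KernelLE κ (PiLp 2 fun _ : Y => E) B := by
  intro f
  simp only [PiLp.norm_sq_eq_of_L2]
  rw [Finset.sum_comm, Finset.sum_comm (s := (Finset.univ : Finset Q)), Finset.mul_sum]
  refine Finset.sum_le_sum fun y _ => ?_
  simpa using hκ fun x => f x y

lemma ell2Norm_sq {ι E : Type*} [Fintype ι] [NormedAddCommGroup E] (f : ι → E) :
    ell2Norm f ^ 2 = (Fintype.card ι : ℝ)⁻¹ * ∑ i, ‖f i‖ ^ 2 := by
  rw [ell2Norm, Real.sq_sqrt]
  · simp [mean, finsum_eq_sum_of_fintype, Nat.card_eq_fintype_card]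
  · simp only [mean, finsum_eq_sum_of_fintype, smul_eq_mul]
    positivity

/-- The factor `(card A)²` undoes the averaging inside `fourier`; the two `ell2Norm` normalizations
cancel, as `A` and its dual have the same order. -/
lemma KernelLE.of_fourierNormLE {A E : Type*} [AddCommGroup A] [Fintype A]
    [NormedAddCommGroup E] [NormedSpace ℂ E] {M : ℝ}
    (hF : FourierNormLE A E M) (e : A ≃ AddChar A ℂ) :
    KernelLE (fun a x => e a x) E (M ^ 2 * (Fintype.card A : ℝ) ^ 2) := by
  intro f
  have hA : (0 : ℝ) < Fintype.card A := by exact_mod_cast Fintype.card_pos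
  have h0 : 0 ≤ ell2Norm (fourier f) := Real.sqrt_nonneg _
  have h1 := pow_le_pow_left₀ h0 (hF f) 2
  rw [mul_pow, ell2Norm_sq, ell2Norm_sq] at h1
  rw [AddChar.card_eq, ← e.sum_comp] at h1
  have h2 : ∀ a, ‖fourier f (e a)‖ ^ 2
      = (Fintype.card A : ℝ)⁻¹ ^ 2 * ‖∑ x, e a x • f x‖ ^ 2 := by
    intro a
    rw [fourier, mean, finsum_eq_sum_of_fintype, norm_smul, mul_pow, Nat.card_eq_fintype_card]
    simp
  simp only [h2, ← Finset.mul_sum] at h1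
  have h3 := mul_le_mul_of_nonneg_left h1 (by positivity : (0:ℝ) ≤ (Fintype.card A : ℝ) ^ 3)
  field_simp at h3
  linarith

end Kernel

/-! ### Fast Fourier transform along digit expansions -/

section FastFourier

variable {R : Type*} [CommRing R]

/-- The element of `R` with digits `s (x k)` in base `P`. -/
def digits {Q : Type*} (s : Q → R) (P : R) {m : ℕ} (x : Fin m → Q) : R :=
  ∑ k : Fin m, P ^ (k : ℕ) * s (x k)

lemma digits_cons {Q : Type*} (s : Q → R) (P : R) {m : ℕ} (q : Q) (x : Fin m → Q) :
    digits s P (Fin.cons q x : Fin (m + 1) → Q) = s q + P * digits s P x := by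
  simp only [digits, Fin.sum_univ_succ, Finset.mul_sum]
  simp [pow_succ', mul_assoc]

lemma digits_snoc {Q : Type*} (s : Q → R) (P : R) {m : ℕ} (q : Q) (x : Fin m → Q) :
    digits s P (Fin.snoc x q : Fin (m + 1) → Q) = digits s P x + P ^ m * s q := by
  simp [digits, Fin.sum_univ_castSucc]

lemma sum_fin_cons {Q M : Type*} [Fintype Q] [AddCommMonoid M] {m : ℕ}
    (g : (Fin (m + 1) → Q) → M) : ∑ x, g x = ∑ q, ∑ y, g (Fin.cons q y) := by
  rw [← (Fin.consEquiv fun _ => Q).sum_comp, Fintype.sum_prod_type]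
  rfl

lemma sum_fin_snoc {Q M : Type*} [Fintype Q] [AddCommMonoid M] {m : ℕ}
    (g : (Fin (m + 1) → Q) → M) : ∑ x, g x = ∑ y, ∑ q, g (Fin.snoc y q) := by
  rw [← (Fin.snocEquiv fun _ => Q).sum_comp, Fintype.sum_prod_type, Finset.sum_comm]
  rfl

/-- If `U (w * y)` acts on the values of `f` as the scalar `ψ y`, the kernel
`U (digits a * (c * digits x))` splits into `m` one-digit Fourier transforms. -/
theorem fast_fourier [IsDomain R] {Q E : Type*} [Fintype Q] [NormedAddCommGroup E]
    [NormedSpace ℂ E] (s : Q → R) (ψ : AddChar R ℂ) {P w : R} (hP : P ≠ 0)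
    (hψ : ∀ y, ψ (P * y) = 1) (U : AddChar R (E →ₗᵢ[ℂ] E)) {B : ℝ} (hB : 0 ≤ B)
    (hκ : KernelLE (fun a x => ψ (s a * s x)) E B) (m : ℕ) :
    ∀ c : R, c * P ^ m = w * P → ∀ f : (Fin m → Q) → E,
      (∀ x y, U (w * y) (f x) = ψ y • f x) →
      ∑ a : Fin m → Q, ‖∑ x, U (digits s P a * (c * digits s P x)) (f x)‖ ^ 2 ≤ B ^ m * ∑ x, ‖f x‖ ^ 2 := by
  induction m with
  | zero =>
    intro c _ f _
    simp [digits]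
  | succ m ih =>
    intro c hc f hf
    have hc' : c * P ^ m = w := mul_right_cancel₀ hP (by rw [← hc, pow_succ, mul_assoc])
    -- Cooley–Tukey step: with the lowest digit `q` of `a` fixed, transform in the highest digit `r`
    -- of `x`, then twist by the cross term of `q` with the remaining digits `y`.
    set g : Q → (Fin m → Q) → E := fun q y =>
      U (s q * (c * digits s P y)) (∑ r, ψ (s q * s r) • f (Fin.snoc y r)) with hg
    have hU : ∀ a b v, U (a + b) v = U a (U b v) := fun a b v => by
      rw [U.map_add_eq_mul]; rfl
    have key : ∀ q b, ∑ x, U (digits s P (Fin.cons q b : Fin (m + 1) → Q) *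
        (c * digits s P x)) (f x) = ∑ y, U (digits s P b * ((c * P) * digits s P y)) (g q y) := by
      intro q b
      rw [sum_fin_snoc]
      refine Finset.sum_congr rfl fun y _ => ?_
      simp only [hg, map_sum]
      refine Finset.sum_congr rfl fun r _ => ?_
      -- As `c * P ^ m = w`, the highest digit of `x` meets `a` only through multiples of `w`, where
      -- `U` is scalar; the part divisible by `P` is killed by `ψ`.
      have h1 : (s q + P * digits s P b) * (c * (digits s P y + P ^ m * s r)) =
          digits s P b * ((c * P) * digits s P y) + (s q * (c * digits s P y) +
            w * (s q * s r + P * (digits s P b * s r))) := by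
        rw [← hc']; ring
      rw [digits_cons, digits_snoc, h1, hU, hU, hf, ψ.map_add_eq_mul, hψ, mul_one]
    rw [sum_fin_cons]
    simp only [key]
    have hgf : ∀ q y z, U (w * z) (g q y) = ψ z • g q y := by
      intro q y z
      simp only [hg]
      rw [← hU, add_comm, hU, map_sum, ← map_smul, Finset.smul_sum]
      congr 1
      refine Finset.sum_congr rfl fun r _ => ?_
      rw [map_smul, hf, smul_comm]
    calc _ ≤ ∑ q, B ^ m * ∑ y, ‖g q y‖ ^ 2 := Finset.sum_le_sum fun q _ =>
          ih (c * P) (by rw [mul_assoc, ← pow_succ', hc]) (g q) (hgf q)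
      _ = B ^ m * ∑ y, ∑ q, ‖g q y‖ ^ 2 := by rw [← Finset.mul_sum, Finset.sum_comm]
      _ ≤ B ^ m * ∑ y, B * ∑ r, ‖f (Fin.snoc y r)‖ ^ 2 := by
          gcongr with y
          simpa only [hg, LinearIsometry.norm_map] using hκ fun r => f (Fin.snoc y r)
      _ = B ^ (m + 1) * ∑ x, ‖f x‖ ^ 2 := by
          rw [sum_fin_snoc, ← Finset.mul_sum, pow_succ, mul_assoc]

end FastFourier

/-! ### Additive characters of a discrete valuation ring -/

section Characters

open IsLocalRing

variable {R : Type*} [CommRing R] [IsDomain R] [IsDiscreteValuationRing R]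

lemma mem_maximalIdeal_pow {p : R} (hp : Irreducible p) {n : ℕ} {r : R} :
    r ∈ maximalIdeal R ^ n ↔ p ^ n ∣ r := by
  rw [hp.maximalIdeal_eq, Ideal.span_singleton_pow, Ideal.mem_span_singleton]

/-- A character of `R` which is trivial on `p ^ h R` and not on `p ^ (h - 1) R` identifies
`R ⧸ p ^ h R` with its dual group. -/
theorem KernelLE.of_primitive {p : R} (hp : Irreducible p) {h : ℕ}
    [Fintype (R ⧸ maximalIdeal R ^ h)] {E : Type*} [NormedAddCommGroup E] [NormedSpace ℂ E] {M : ℝ}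
    (hF : FourierNormLE (R ⧸ maximalIdeal R ^ h) E M) (ψ : AddChar R ℂ)
    (hψ : ∀ y, ψ (p ^ h * y) = 1) (hψ' : ∃ y, ψ (p ^ (h - 1) * y) ≠ 1) :
    KernelLE (fun a x : R ⧸ maximalIdeal R ^ h => ψ (Quotient.out a * Quotient.out x)) E
      (M ^ 2 * (Fintype.card (R ⧸ maximalIdeal R ^ h) : ℝ) ^ 2) := by
  have hout : ∀ r : R, ∃ y, Quotient.out (Ideal.Quotient.mk (maximalIdeal R ^ h) r) =
      r + p ^ h * y := by
    intro r
    have : Quotient.out (Ideal.Quotient.mk (maximalIdeal R ^ h) r) - r ∈ maximalIdeal R ^ h :=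
      Ideal.Quotient.eq.1 (Quotient.out_eq _)
    obtain ⟨y, hy⟩ := (mem_maximalIdeal_pow hp).1 this
    exact ⟨y, by rw [← hy]; ring⟩
  have hmk : ∀ a r : R, ψ (a * Quotient.out (Ideal.Quotient.mk (maximalIdeal R ^ h) r)) =
      ψ (a * r) := by
    intro a r
    obtain ⟨y, hy⟩ := hout r
    rw [hy, show a * (r + p ^ h * y) = a * r + p ^ h * (a * y) by ring, ψ.map_add_eq_mul, hψ,
      mul_one]
  let χ : R ⧸ maximalIdeal R ^ h → AddChar (R ⧸ maximalIdeal R ^ h) ℂ := fun a =>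
    { toFun := fun x => ψ (Quotient.out a * Quotient.out x)
      map_zero_eq_one' := by
        rw [← map_zero (Ideal.Quotient.mk (maximalIdeal R ^ h)), hmk]; simp
      map_add_eq_mul' := by
        intro x y
        obtain ⟨x, rfl⟩ := Ideal.Quotient.mk_surjective x
        obtain ⟨y, rfl⟩ := Ideal.Quotient.mk_surjective y
        rw [← map_add, hmk, hmk, hmk, mul_add, ψ.map_add_eq_mul] }
  have hinj : Function.Injective χ := by
    intro a b hab
    have h1 : ∀ y : R, ψ ((Quotient.out a - Quotient.out b) * y) = 1 := by
      intro y
      have h2 : ψ (Quotient.out a * y) = ψ (Quotient.out b * y) := by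
        have := DFunLike.congr_fun hab (Ideal.Quotient.mk (maximalIdeal R ^ h) y)
        change ψ (_ * Quotient.out (Ideal.Quotient.mk _ y)) =
          ψ (_ * Quotient.out (Ideal.Quotient.mk _ y)) at this
        rwa [hmk, hmk] at this
      rw [sub_mul, sub_eq_add_neg, ψ.map_add_eq_mul, h2, ← ψ.map_add_eq_mul, add_neg_cancel,
        ψ.map_zero_eq_one]
    have h3 : Quotient.out a - Quotient.out b ∈ maximalIdeal R ^ h := by
      rw [mem_maximalIdeal_pow hp]
      by_contra hd
      have hne : Quotient.out a - Quotient.out b ≠ 0 := fun h0 => hd (h0 ▸ dvd_zero _)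
      obtain ⟨n, u, hu⟩ := IsDiscreteValuationRing.eq_unit_mul_pow_irreducible hne hp
      have hn : n < h := by
        by_contra hn
        exact hd (hu ▸ Dvd.dvd.mul_left (pow_dvd_pow p (not_lt.1 hn)) _)
      obtain ⟨y, hy⟩ := hψ'
      apply hy
      -- If the difference is `u * p ^ n` with `n < h`, this multiplier carries it to `p ^ (h - 1) *
      -- y`, where `ψ` is not 1.
      have h4 := h1 (↑u⁻¹ * (p ^ (h - 1 - n) * y))
      rw [hu] at h4
      rw [← h4]
      congr 1
      calc p ^ (h - 1) * y = p ^ (n + (h - 1 - n)) * y := by congr 2; omega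
        _ = (↑u * ↑u⁻¹ : R) * p ^ (n + (h - 1 - n)) * y := by simp
        _ = _ := by rw [pow_add]; ring
    rw [← Ideal.Quotient.eq] at h3
    have ho : ∀ c : R ⧸ maximalIdeal R ^ h, Ideal.Quotient.mk (maximalIdeal R ^ h) (Quotient.out c) = c :=
      fun c => Quotient.out_eq c
    rwa [ho, ho] at h3
  have hbij : Function.Bijective χ := by
    rw [Fintype.bijective_iff_injective_and_card]
    exact ⟨hinj, AddChar.card_eq.symm⟩
  exact KernelLE.of_fourierNormLE hF (Equiv.ofBijective χ hbij)

end Characters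

/-! ### Components of a function along a character -/

section CharacterComponents

variable {R : Type*} [CommRing R]

/-- The translation action of `R` on `ℓ²(R ⧸ I, E)`. -/
def translate (I : Ideal R) [Fintype (R ⧸ I)] (E : Type*) [NormedAddCommGroup E]
    [NormedSpace ℂ E] :
    AddChar R ((PiLp 2 fun _ : R ⧸ I => E) →ₗᵢ[ℂ] (PiLp 2 fun _ : R ⧸ I => E)) where
  toFun r := (LinearIsometryEquiv.piLpCongrLeft 2 ℂ E
    (Equiv.subRight (Ideal.Quotient.mk I r))).toLinearIsometry
  map_zero_eq_one' := by ext f b; simp [LinearIsometryEquiv.piLpCongrLeft_apply]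
  map_add_eq_mul' r r' := by
    ext f b
    simp [LinearIsometryEquiv.piLpCongrLeft_apply, add_assoc, Equiv.piCongrLeft']

lemma exists_out_eq_add {I : Ideal R} (r : R) :
    ∃ i ∈ I, Quotient.out (Ideal.Quotient.mk I r) = r + i :=
  ⟨Quotient.out (Ideal.Quotient.mk I r) - r, Ideal.Quotient.eq.1 (Quotient.out_eq _),
    (add_sub_cancel r _).symm⟩

/-- If `F (y - a x - b)` is the pairing of an operator depending on `(a, b)` and a vector
depending on `(x, y)`, the fast Fourier transform bounds the component of `F` along a
character. -/
theorem norm_sum_char_smul_le [IsDomain R] (I J : Ideal R) [Fintype (R ⧸ I)] [Fintype (R ⧸ J)]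
    {Q : Type*} [Fintype Q] [Nonempty Q] (s : Q → R) {E W : Type*} [NormedAddCommGroup E]
    [NormedSpace ℂ E] [NormedAddCommGroup W] [NormedSpace ℂ W] {M B₁ B₂ : ℝ} (hM : 0 ≤ M)
    (θ : AddChar (R ⧸ J) ℂ) (ψ : AddChar R ℂ) {P w d c c₀ : R} (hP : P ≠ 0)
    (hψP : ∀ y, ψ (P * y) = 1) (hψ : ∀ y, ψ y = θ (Ideal.Quotient.mk J (d * y)))
    (hJ : ∀ r ∈ J, w * r ∈ I)
    (hκ : KernelLE (fun a x => ψ (s a * s x)) E (M ^ 2 * (Fintype.card Q : ℝ) ^ 2))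
    (m : ℕ) (hc : c * P ^ m = w * d * P) (hc₀ : c₀ ∣ c) (F : R → W)
    (hF : ∀ z, ∀ r ∈ I, F (z + r) = F z) (T : R → R → (E →L[ℂ] W)) (e : R → R → E)
    (hTe : ∀ a b x y, c₀ ∣ x → T a b (e x y) = F (y - a * x - b))
    (hB₁ : ∀ a b, ‖T a b‖ ≤ B₁) (hB₂ : ∀ x y, c₀ ∣ x → ‖e x y‖ ≤ B₂) :
    ‖∑ y : R ⧸ J, θ (-y) • F (w * Quotient.out y)‖ ≤
      Fintype.card (R ⧸ J) * (B₁ * B₂ * M ^ m) := by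
  set Z := ∑ y : R ⧸ J, θ (-y) • F (w * Quotient.out y) with hZ
  have hB₁0 : 0 ≤ B₁ := (norm_nonneg _).trans (hB₁ 0 0)
  have hB₂0 : 0 ≤ B₂ := (norm_nonneg _).trans (hB₂ 0 0 (dvd_zero _))
  let U := translate I E
  have hU : ∀ a b v, U (a + b) v = U a (U b v) := fun a b v => by
    rw [U.map_add_eq_mul]; rfl
  let E₂ := PiLp 2 fun _ : R ⧸ I => E
  let ε : R → E₂ := fun x => WithLp.toLp 2 fun b => e x (Quotient.out b)
  -- The `θ`-component of the function `b ↦ e (c x) b` under translations by `w R`; this is what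
  -- makes `U (w * d * r)` act on it by the scalar `ψ r`.
  let g : (Fin m → Q) → E₂ := fun x =>
    ∑ y : R ⧸ J, θ (-y) • U (w * Quotient.out y) (ε (c * digits s P x))
  have hdvd : ∀ x : Fin m → Q, c₀ ∣ c * digits s P x := fun x => Dvd.dvd.mul_right hc₀ _
  have hUJ : ∀ r ∈ J, ∀ v : E₂, U (w * r) v = v := by
    intro r hr v
    ext b
    change v (b + Ideal.Quotient.mk I (w * r)) = v b
    rw [Ideal.Quotient.eq_zero_iff_mem.2 (hJ r hr), add_zero]
  have hUout : ∀ (r : R) (v : E₂), U (w * Quotient.out (Ideal.Quotient.mk J r)) v =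
      U (w * r) v := by
    intro r v
    obtain ⟨i, hi, h⟩ := exists_out_eq_add (I := J) r
    rw [h, mul_add, hU, hUJ i hi]
  have hg : ∀ x r, U (w * d * r) (g x) = ψ r • g x := by
    intro x r
    simp only [g, map_sum, Finset.smul_sum, map_smul]
    rw [← Equiv.sum_comp (Equiv.addRight (Ideal.Quotient.mk J (d * r)))
      (fun y : R ⧸ J => ψ r • θ (-y) • U (w * Quotient.out y) (ε (c * digits s P x)))]
    refine Finset.sum_congr rfl fun y _ => ?_
    obtain ⟨y, rfl⟩ := Ideal.Quotient.mk_surjective y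
    simp only [Equiv.coe_addRight]
    rw [← map_add, hUout, hUout, ← hU, smul_smul, hψ, ← AddChar.map_add_eq_mul]
    congr 2
    · rw [← map_neg, ← map_neg, ← map_add]
      congr 1
      ring
    · ring_nf
  have hgn : ∀ x, ‖g x‖ ^ 2 ≤
      (Fintype.card (R ⧸ J) : ℝ) ^ 2 * (Fintype.card (R ⧸ I) * B₂ ^ 2) := by
    intro x
    have h1 : ‖ε (c * digits s P x)‖ ^ 2 ≤ Fintype.card (R ⧸ I) * B₂ ^ 2 := by
      rw [PiLp.norm_sq_eq_of_L2]
      calc _ ≤ ∑ b : R ⧸ I, B₂ ^ 2 := Finset.sum_le_sum fun b _ =>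
            pow_le_pow_left₀ (norm_nonneg _) (hB₂ _ _ (hdvd x)) 2
        _ = _ := by simp
    have h2 : ‖g x‖ ≤ Fintype.card (R ⧸ J) * ‖ε (c * digits s P x)‖ := by
      have h3 : ∀ y : R ⧸ J, ‖θ (-y) • U (w * Quotient.out y) (ε (c * digits s P x))‖ =
          ‖ε (c * digits s P x)‖ := fun y => by
        rw [norm_smul, AddChar.norm_apply, one_mul]
        exact LinearIsometry.norm_map _ _
      refine (norm_sum_le _ _).trans ?_
      simp only [h3]
      simp
    calc ‖g x‖ ^ 2 ≤ (Fintype.card (R ⧸ J) * ‖ε (c * digits s P x)‖) ^ 2 :=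
          pow_le_pow_left₀ (norm_nonneg _) h2 2
      _ ≤ _ := by rw [mul_pow]; gcongr
  -- Translating by `a c x` cancels the term `-a c x` in the argument of `F`, so the pairing is the
  -- same for all `a`, `x`, `b`. Summing over `x` gives a vector of size about `card Q ^ m * ‖Z‖`,
  -- against which the Fourier bound is played.
  have hpair : ∀ (a x : Fin m → Q) (b : R ⧸ I),
      T (digits s P a) (Quotient.out b)
        (U (digits s P a * (c * digits s P x)) (g x) b) = Z := by
    intro a x b
    simp only [g, map_sum, map_smul, hZ]
    rw [WithLp.ofLp_sum, Finset.sum_apply, map_sum]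
    refine Finset.sum_congr rfl fun y _ => ?_
    rw [WithLp.ofLp_smul, Pi.smul_apply, map_smul, ← hU]
    congr 1
    change T _ _ (e _ (Quotient.out (b + Ideal.Quotient.mk I _))) = _
    rw [hTe _ _ _ _ (hdvd x)]
    obtain ⟨b, rfl⟩ := Ideal.Quotient.mk_surjective b
    rw [← map_add]
    obtain ⟨i, hi, h1⟩ := exists_out_eq_add (I := I) b
    obtain ⟨i', hi', h2⟩ := exists_out_eq_add (I := I) (b +
      (digits s P a * (c * digits s P x) + w * Quotient.out y))
    rw [h1, h2]
    exact (congrArg F (by ring_nf)).trans (hF _ _ (I.sub_mem hi' hi))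
  have hsum : ∀ (a : Fin m → Q) (b : R ⧸ I),
      ((Fintype.card Q : ℝ) ^ m) ^ 2 * ‖Z‖ ^ 2 ≤
        B₁ ^ 2 * ‖(∑ x, U (digits s P a * (c * digits s P x)) (g x)) b‖ ^ 2 := by
    intro a b
    rw [← mul_pow, ← mul_pow]
    refine pow_le_pow_left₀ (by positivity) ?_ 2
    calc (Fintype.card Q : ℝ) ^ m * ‖Z‖ = ‖∑ x : Fin m → Q, Z‖ := by
          simp [← Nat.cast_smul_eq_nsmul ℂ, norm_smul]
      _ = ‖T (digits s P a) (Quotient.out b)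
            ((∑ x, U (digits s P a * (c * digits s P x)) (g x)) b)‖ := by
          rw [WithLp.ofLp_sum, Finset.sum_apply, map_sum]
          simp only [hpair]
      _ ≤ _ := (ContinuousLinearMap.le_opNorm _ _).trans (by gcongr; exact hB₁ _ _)
  have hfft := fast_fourier s ψ hP hψP U (by positivity) hκ.piLp m c hc g hg
  have hq : (0 : ℝ) < Fintype.card Q := by exact_mod_cast Fintype.card_pos
  have hI : (0 : ℝ) < Fintype.card (R ⧸ I) := by exact_mod_cast Fintype.card_pos
  have htot : (Fintype.card Q : ℝ) ^ m * (Fintype.card (R ⧸ I) *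
      (((Fintype.card Q : ℝ) ^ m) ^ 2 * ‖Z‖ ^ 2)) ≤ B₁ ^ 2 *
        ((M ^ 2 * (Fintype.card Q : ℝ) ^ 2) ^ m * ((Fintype.card Q : ℝ) ^ m *
          ((Fintype.card (R ⧸ J) : ℝ) ^ 2 * (Fintype.card (R ⧸ I) * B₂ ^ 2)))) := by
    calc _ = ∑ a : Fin m → Q, ∑ b : R ⧸ I, (((Fintype.card Q : ℝ) ^ m) ^ 2 * ‖Z‖ ^ 2) := by
          simp
      _ ≤ ∑ a : Fin m → Q, ∑ b : R ⧸ I,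
          B₁ ^ 2 * ‖(∑ x, U (digits s P a * (c * digits s P x)) (g x)) b‖ ^ 2 :=
          Finset.sum_le_sum fun a _ => Finset.sum_le_sum fun b _ => hsum a b
      _ = B₁ ^ 2 * ∑ a : Fin m → Q,
          ‖∑ x, U (digits s P a * (c * digits s P x)) (g x)‖ ^ 2 := by
          simp only [← Finset.mul_sum, PiLp.norm_sq_eq_of_L2]
      _ ≤ B₁ ^ 2 * ((M ^ 2 * (Fintype.card Q : ℝ) ^ 2) ^ m * ∑ x, ‖g x‖ ^ 2) := by gcongr
      _ ≤ B₁ ^ 2 * ((M ^ 2 * (Fintype.card Q : ℝ) ^ 2) ^ m * ∑ x : Fin m → Q,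
          ((Fintype.card (R ⧸ J) : ℝ) ^ 2 * (Fintype.card (R ⧸ I) * B₂ ^ 2))) := by
          gcongr with x; exact hgn x
      _ = _ := by simp
  have hX : (0 : ℝ) < (Fintype.card Q : ℝ) ^ m := by positivity
  rw [mul_pow, ← pow_mul, ← pow_mul, mul_comm 2 m, pow_mul, pow_mul] at htot
  set X := (Fintype.card Q : ℝ) ^ m
  have hfin : ‖Z‖ ^ 2 ≤ (Fintype.card (R ⧸ J) * (B₁ * B₂ * M ^ m)) ^ 2 := by
    refine le_of_mul_le_mul_left ?_ (by positivity : 0 < X * (Fintype.card (R ⧸ I) * X ^ 2))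
    calc _ = X * (Fintype.card (R ⧸ I) * (X ^ 2 * ‖Z‖ ^ 2)) := by ring
      _ ≤ _ := htot
      _ = _ := by ring
  exact le_of_sq_le_sq hfin (by positivity)

end CharacterComponents

/-! ### From character components to differences of values -/

section Difference

open IsLocalRing

variable {R : Type*} [CommRing R]

/-- Fourier inversion on a finite abelian group, from the orthogonality of characters. -/
lemma card_smul_eq_sum_char_smul {S W : Type*} [AddCommGroup S] [Fintype S]
    [AddCommGroup W] [Module ℂ W] (G : S → W) (y₀ : S) :
    (Fintype.card S : ℂ) • G y₀ =
      ∑ θ : AddChar S ℂ, θ y₀ • ∑ y, θ (-y) • G y := by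
  classical
  simp only [Finset.smul_sum, smul_smul]
  rw [Finset.sum_comm]
  simp only [← AddChar.map_add_eq_mul, ← Finset.sum_smul, AddChar.sum_apply_eq_ite]
  rw [Finset.sum_eq_single y₀]
  · simp
  · intro y _ hy
    rw [if_neg, zero_smul]
    rwa [← sub_eq_add_neg, sub_eq_zero, eq_comm]
  · simp

variable [IsDomain R] [IsDiscreteValuationRing R]

/-- The values of `F` at `0` and at `p ^ (j - t)` are close when `F (y - a x - b)` is a pairing of
an operator depending on `(a, b)` and a vector depending on `(x, y)`. -/
theorem norm_apply_zero_sub_apply_pow_le [∀ n, Finite (R ⧸ maximalIdeal R ^ n)] {p : R}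
    (hp : Irreducible p) {h t N j : ℕ} (hh : 1 ≤ h) (hj : h + t + N ≤ j)
    {E W : Type*} [NormedAddCommGroup E] [NormedSpace ℂ E] [NormedAddCommGroup W]
    [NormedSpace ℂ W] {α : ℝ} (hα : 0 ≤ α)
    (hF : FourierNormLE (R ⧸ maximalIdeal R ^ h) E (Real.exp (-α)))
    {B₁ B₂ : ℝ} (F : R → W) (hper : ∀ z r, F (z + p ^ j * r) = F z)
    (T : R → R → (E →L[ℂ] W)) (e : R → R → E)
    (hTe : ∀ a b x y, p ^ N ∣ x → T a b (e x y) = F (y - a * x - b))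
    (hB₁ : ∀ a b, ‖T a b‖ ≤ B₁) (hB₂ : ∀ x y, p ^ N ∣ x → ‖e x y‖ ≤ B₂) :
    ‖F 0 - F (p ^ (j - t))‖ ≤ 2 * Nat.card (R ⧸ maximalIdeal R ^ (h + t)) *
      Real.exp (α * (h + t + N) / h) * (B₁ * B₂ * Real.exp (-(α * j / h))) := by
  -- With this scale, `0` and `p ^ (j - t)` correspond to the classes of `0` and `p ^ h` modulo `p ^
  -- s`. In the difference only characters `θ` with `θ (p ^ h) ≠ 1` survive.
  set s := h + t with hs
  set J := maximalIdeal R ^ s with hJ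
  have : Fintype (R ⧸ J) := Fintype.ofFinite _
  have : Fintype (R ⧸ maximalIdeal R ^ j) := Fintype.ofFinite _
  have : Fintype (R ⧸ maximalIdeal R ^ h) := Fintype.ofFinite _
  have hB₁0 : 0 ≤ B₁ := (norm_nonneg _).trans (hB₁ 0 0)
  have hB₂0 : 0 ≤ B₂ := (norm_nonneg _).trans (hB₂ 0 0 (dvd_zero _))
  have hh' : (0 : ℝ) < h := by exact_mod_cast hh
  have hp0 := hp.ne_zero
  have hI : ∀ z, ∀ r ∈ maximalIdeal R ^ j, F (z + r) = F z := by
    intro z r hr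
    obtain ⟨y, rfl⟩ := (mem_maximalIdeal_pow hp).1 hr
    exact hper z y
  have hwJ : ∀ r ∈ J, p ^ (j - s) * r ∈ maximalIdeal R ^ j := by
    intro r hr
    obtain ⟨y, rfl⟩ := (mem_maximalIdeal_pow hp).1 hr
    rw [mem_maximalIdeal_pow hp, ← mul_assoc, ← pow_add, Nat.sub_add_cancel (by omega)]
    exact dvd_mul_right _ _
  set G : R ⧸ J → W := fun y => F (p ^ (j - s) * Quotient.out y) with hG
  have hGmk : ∀ r, G (Ideal.Quotient.mk J r) = F (p ^ (j - s) * r) := by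
    intro r
    obtain ⟨i, hi, h1⟩ := exists_out_eq_add (I := J) r
    rw [hG]
    simp only [h1]
    rw [mul_add, hI _ _ (hwJ i hi)]
  have hG0 : G 0 = F 0 := by rw [← map_zero (Ideal.Quotient.mk J), hGmk, mul_zero]
  have hG1 : G (Ideal.Quotient.mk J (p ^ h)) = F (p ^ (j - t)) := by
    rw [hGmk, ← pow_add]; congr 2; omega
  set D := B₁ * B₂ * (Real.exp (-(α * j / h)) * Real.exp (α * (s + N) / h)) with hD
  have hcomp : ∀ θ : AddChar (R ⧸ J) ℂ, θ (Ideal.Quotient.mk J (p ^ h)) ≠ 1 →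
      ‖∑ y, θ (-y) • G y‖ ≤ Fintype.card (R ⧸ J) * D := by
    intro θ hθ
    classical
    have hex : ∃ n, ∀ y, θ (Ideal.Quotient.mk J (p ^ n * y)) = 1 := by
      refine ⟨s, fun y => ?_⟩
      rw [Ideal.Quotient.eq_zero_iff_mem.2
        ((mem_maximalIdeal_pow hp).2 (dvd_mul_right _ _)), θ.map_zero_eq_one]
    -- `n` is the conductor exponent of `θ`. Nontriviality at `p ^ h` forces `n > h`, so `y ↦ θ (p ^
    -- (n - h) * y)` has conductor exponent exactly `h`.
    obtain ⟨n, hn, hmin⟩ : ∃ n, (∀ y, θ (Ideal.Quotient.mk J (p ^ n * y)) = 1) ∧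
        ∀ k < n, ¬ ∀ y, θ (Ideal.Quotient.mk J (p ^ k * y)) = 1 :=
      ⟨Nat.find hex, Nat.find_spec hex, fun k hk => Nat.find_min hex hk⟩
    have hhn : h < n := by
      by_contra hle
      apply hθ
      have := hn (p ^ (h - n))
      rwa [← pow_add, Nat.add_sub_of_le (not_lt.1 hle)] at this
    have hns : n ≤ s := by
      by_contra hlt
      refine hmin s (not_le.1 hlt) fun y => ?_
      rw [Ideal.Quotient.eq_zero_iff_mem.2
        ((mem_maximalIdeal_pow hp).2 (dvd_mul_right _ _)), θ.map_zero_eq_one]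
    let ψ : AddChar R ℂ :=
      { toFun := fun y => θ (Ideal.Quotient.mk J (p ^ (n - h) * y))
        map_zero_eq_one' := by simp
        map_add_eq_mul' := by intro x y; rw [mul_add, map_add, θ.map_add_eq_mul] }
    have hψ1 : ∀ y, ψ (p ^ h * y) = 1 := by
      intro y
      change θ (Ideal.Quotient.mk J (p ^ (n - h) * (p ^ h * y))) = 1
      rw [← mul_assoc, ← pow_add, Nat.sub_add_cancel hhn.le]
      exact hn y
    have hψ2 : ∃ y, ψ (p ^ (h - 1) * y) ≠ 1 := by
      obtain ⟨y, hy⟩ := not_forall.1 (hmin (n - 1) (by omega))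
      refine ⟨y, ?_⟩
      change θ (Ideal.Quotient.mk J (p ^ (n - h) * (p ^ (h - 1) * y))) ≠ 1
      rw [← mul_assoc, ← pow_add, show n - h + (h - 1) = n - 1 by omega]
      exact hy
    -- `p ^ (N + k)` equals `w * d * P`. Reserving `p ^ N` for the divisibility of `x` leaves `k /
    -- h` full blocks of `h` digits; the remainder `k % h` goes into `c`.
    set k := j - s + (n - h) + h - N with hk
    have hdm := Nat.div_add_mod k h
    have hmod := Nat.mod_lt k (by omega : 0 < h)
    have key := norm_sum_char_smul_le (maximalIdeal R ^ j) J
      (fun x : R ⧸ maximalIdeal R ^ h => Quotient.out x) (Real.exp_nonneg (-α))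
      θ ψ (pow_ne_zero h hp0) hψ1 (d := p ^ (n - h)) (fun _ => rfl) hwJ
      (KernelLE.of_primitive hp hF ψ hψ1 hψ2) (k / h) (c := p ^ (N + k % h)) (c₀ := p ^ N)
      (by
        rw [← pow_mul, ← pow_add, ← pow_add, ← pow_add]
        congr 1
        omega)
      (pow_dvd_pow _ (Nat.le_add_right _ _)) F hI T e hTe hB₁ hB₂
    refine key.trans ?_
    rw [hD]
    gcongr
    rw [← Real.exp_nat_mul, ← Real.exp_add]
    apply Real.exp_le_exp.2
    have h1 : j ≤ s + N + h * (k / h) := by omega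
    have h2 : (j : ℝ) ≤ s + N + h * ((k / h : ℕ) : ℝ) := by exact_mod_cast h1
    have h3 : α * j / h ≤ α * (s + N + h * ((k / h : ℕ) : ℝ)) / h := by gcongr
    have h4 : α * (s + N + h * ((k / h : ℕ) : ℝ)) / h =
      α * (s + N) / h + ((k / h : ℕ) : ℝ) * α := by field_simp
    linarith
  have hS : (0 : ℝ) < Fintype.card (R ⧸ J) := by exact_mod_cast Fintype.card_pos
  have hmain : (Fintype.card (R ⧸ J) : ℝ) * ‖F 0 - F (p ^ (j - t))‖ ≤
      Fintype.card (R ⧸ J) * (2 * (Fintype.card (R ⧸ J) * D)) := by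
    calc (Fintype.card (R ⧸ J) : ℝ) * ‖F 0 - F (p ^ (j - t))‖
        = ‖(Fintype.card (R ⧸ J) : ℂ) • (G 0 - G (Ideal.Quotient.mk J (p ^ h)))‖ := by
          rw [norm_smul, hG0, hG1]; simp
      _ = ‖∑ θ : AddChar (R ⧸ J) ℂ,
            (1 - θ (Ideal.Quotient.mk J (p ^ h))) • ∑ y, θ (-y) • G y‖ := by
          rw [smul_sub, card_smul_eq_sum_char_smul, card_smul_eq_sum_char_smul,
            ← Finset.sum_sub_distrib]
          simp only [AddChar.map_zero_eq_one, sub_smul]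
      _ ≤ ∑ θ : AddChar (R ⧸ J) ℂ, 2 * (Fintype.card (R ⧸ J) * D) := by
          refine norm_sum_le_of_le _ fun θ _ => ?_
          by_cases hθ : θ (Ideal.Quotient.mk J (p ^ h)) = 1
          · rw [hθ, sub_self, zero_smul, norm_zero]
            positivity
          · rw [norm_smul]
            refine mul_le_mul ?_ (hcomp θ hθ) (norm_nonneg _) (by norm_num)
            refine (norm_sub_le _ _).trans ?_
            rw [norm_one, AddChar.norm_apply]
            norm_num
      _ = _ := by
          rw [Finset.sum_const, Finset.card_univ, AddChar.card_eq, nsmul_eq_mul]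
  refine (le_of_mul_le_mul_left hmain hS).trans (le_of_eq ?_)
  rw [hD, Nat.card_eq_fintype_card, hs]
  push_cast
  ring

end Difference

/-! ### Matrix identities in `SL₃(𝒪)` and `G'` -/

section Matrices

open ValuativeRel IsLocalRing

local notation "SL₃" R => Matrix.SpecialLinearGroup (Fin 3) R

/-- The kernel of the reduction of `SL₃(R)` modulo the `n`-th power of the maximal ideal. -/
def congruenceSubgroup (R : Type*) [CommRing R] [IsLocalRing R] (n : ℕ) : Subgroup (SL₃ R) :=
  (Matrix.SpecialLinearGroup.map (Ideal.Quotient.mk (maximalIdeal R ^ n))).ker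

lemma mem_congruenceSubgroup {R : Type*} [CommRing R] [IsLocalRing R] {n : ℕ} {k : SL₃ R} :
    k ∈ congruenceSubgroup R n ↔
      ∀ a b, k.1 a b - (1 : Matrix (Fin 3) (Fin 3) R) a b ∈ maximalIdeal R ^ n := by
  rw [congruenceSubgroup, MonoidHom.mem_ker, Matrix.SpecialLinearGroup.ext_iff]
  refine forall₂_congr fun a b => ?_
  rw [← Ideal.Quotient.eq]
  simp only [Matrix.SpecialLinearGroup.map_apply_coe, RingHom.mapMatrix_apply, Matrix.map_apply,
    Matrix.SpecialLinearGroup.coe_one, Matrix.one_apply]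
  split_ifs <;> simp

section Elements

variable {R : Type*} [CommRing R]

/-- The matrix of determinant one whose top left corner is `z`, the pairing of a line and a
hyperplane. -/
def cornerElt (z : R) : SL₃ R := ⟨!![z, 0, 1; 1, 0, 0; 0, 1, 0], by simp [Matrix.det_fin_three]⟩

@[simp]
lemma coe_cornerElt (z : R) :
    ((cornerElt z : SL₃ R) : Matrix (Fin 3) (Fin 3) R) = !![z, 0, 1; 1, 0, 0; 0, 1, 0] := rfl

/-- A matrix with first row `(-b, -a, 1)`. -/
def rowElt (a b : R) : SL₃ R := ⟨!![-b, -a, 1; 1, 0, 0; 0, 1, 0], by simp [Matrix.det_fin_three]⟩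

@[simp]
lemma coe_rowElt (a b : R) :
    ((rowElt a b : SL₃ R) : Matrix (Fin 3) (Fin 3) R) = !![-b, -a, 1; 1, 0, 0; 0, 1, 0] := rfl

/-- A matrix with first column `(1, x, y)`. -/
def colElt (x y : R) : SL₃ R := ⟨!![1, 0, 0; x, 1, 0; y, 0, 1], by simp [Matrix.det_fin_three]⟩

@[simp]
lemma coe_colElt (x y : R) :
    ((colElt x y : SL₃ R) : Matrix (Fin 3) (Fin 3) R) = !![1, 0, 0; x, 1, 0; y, 0, 1] := rfl

/-- The elementary matrix with entry `x` at the place `(3, 2)`. -/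
def elem32 (x : R) : SL₃ R := ⟨!![1, 0, 0; 0, 1, 0; 0, x, 1], by simp [Matrix.det_fin_three]⟩

@[simp]
lemma coe_elem32 (x : R) :
    ((elem32 x : SL₃ R) : Matrix (Fin 3) (Fin 3) R) = !![1, 0, 0; 0, 1, 0; 0, x, 1] := rfl

/-- The elementary matrix with entry `x` at the place `(2, 1)`. -/
def elem21 (x : R) : SL₃ R := ⟨!![1, 0, 0; x, 1, 0; 0, 0, 1], by simp [Matrix.det_fin_three]⟩

@[simp]
lemma coe_elem21 (x : R) :
    ((elem21 x : SL₃ R) : Matrix (Fin 3) (Fin 3) R) = !![1, 0, 0; x, 1, 0; 0, 0, 1] := rfl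

/-- The elementary matrix with entry `x` at the place `(3, 1)`. -/
def elem31 (x : R) : SL₃ R := ⟨!![1, 0, 0; 0, 1, 0; x, 0, 1], by simp [Matrix.det_fin_three]⟩

@[simp]
lemma coe_elem31 (x : R) :
    ((elem31 x : SL₃ R) : Matrix (Fin 3) (Fin 3) R) = !![1, 0, 0; 0, 1, 0; x, 0, 1] := rfl

/-- An upper triangular elementary matrix times a permutation matrix. -/
def rotElt (x : R) : SL₃ R := ⟨!![1, 0, x; 0, 0, -1; 0, 1, 0], by simp [Matrix.det_fin_three]⟩

@[simp]
lemma coe_rotElt (x : R) :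
    ((rotElt x : SL₃ R) : Matrix (Fin 3) (Fin 3) R) = !![1, 0, x; 0, 0, -1; 0, 1, 0] := rfl

/-- The corner entry is the scalar product of `(-b, -a, 1)` and `(1, x, y)`. The other entries are
absorbed by `elem32` factors, which commute with `D(m, 0)`. -/
lemma rowElt_mul_colElt (a b x y : R) :
    rowElt a b * colElt x y = elem32 x * cornerElt (y - a * x - b) * elem32 (-a) := by
  ext i j
  fin_cases i <;> fin_cases j <;>
    simp [Matrix.mul_apply, Fin.sum_univ_three]
  ring

lemma cornerElt_add (z r : R) : cornerElt (z + r) = cornerElt z * elem31 r := by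
  ext i j
  fin_cases i <;> fin_cases j <;>
    simp [Matrix.mul_apply, Fin.sum_univ_three]

lemma elem32_mem_congruenceSubgroup [IsLocalRing R] {n : ℕ} {x : R}
    (hx : x ∈ maximalIdeal R ^ n) : elem32 x ∈ congruenceSubgroup R n := by
  rw [mem_congruenceSubgroup]
  intro i j
  fin_cases i <;> fin_cases j <;> simp [hx]

lemma elem21_mem_congruenceSubgroup [IsLocalRing R] {n : ℕ} {x : R}
    (hx : x ∈ maximalIdeal R ^ n) : elem21 x ∈ congruenceSubgroup R n := by
  rw [mem_congruenceSubgroup]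
  intro i j
  fin_cases i <;> fin_cases j <;> simp [hx]

end Elements

variable {F : Type*} [Field F] {ϖ : Fˣ}

/-- The element `g` of `G'` is the class of the matrix `A`. -/
def Represents (g : GPrime ϖ) (A : Matrix (Fin 3) (Fin 3) F) : Prop :=
  ∃ x : detPow ϖ, (QuotientGroup.mk x : GPrime ϖ) = g ∧ ((x : GL (Fin 3) F) : Matrix _ _ F) = A

lemma Represents.mul {g g' : GPrime ϖ} {A A' : Matrix (Fin 3) (Fin 3) F} (h : Represents g A)
    (h' : Represents g' A') : Represents (g * g') (A * A') := by
  obtain ⟨x, rfl, rfl⟩ := h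
  obtain ⟨y, rfl, rfl⟩ := h'
  exact ⟨x * y, rfl, rfl⟩

lemma Represents.eq {g g' : GPrime ϖ} {A A' : Matrix (Fin 3) (Fin 3) F} (h : Represents g A)
    (h' : Represents g' A') (hA : A = A') : g = g' := by
  obtain ⟨x, rfl, rfl⟩ := h
  obtain ⟨y, rfl, hy⟩ := h'
  exact congrArg _ (Subtype.ext (Units.ext (hA.trans hy.symm)))

lemma represents_diagElt (i j : ℕ) : Represents (diagElt ϖ i j) (diagMatrix ϖ i j) :=
  ⟨_, rfl, rfl⟩

variable [ValuativeRel F]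

lemma represents_ofK (k : SL₃ 𝒪[F]) : Represents (ofK ϖ k) (k.1.map fun r => (r : F)) :=
  ⟨_, rfl, rfl⟩

lemma commute_elem32_diagElt (x : 𝒪[F]) (m : ℕ) :
    ofK ϖ (elem32 x) * diagElt ϖ m 0 = diagElt ϖ m 0 * ofK ϖ (elem32 x) := by
  refine ((represents_ofK _).mul (represents_diagElt _ _)).eq
    ((represents_diagElt _ _).mul (represents_ofK _)) ?_
  ext i j
  fin_cases i <;> fin_cases j <;>
    simp [diagMatrix, Matrix.mul_apply, Fin.sum_univ_three]

variable {p : 𝒪[F]} (hp : (p : F) = ϖ)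
include hp

/-- Conjugation by `D(m, 0)` divides the entry by `ϖ ^ m`; this is the source of the periodicity of
the coefficient in `z` modulo `p ^ j`. -/
lemma elem31_mul_diagElt (r : 𝒪[F]) (m : ℕ) :
    ofK ϖ (elem31 (p ^ m * r)) * diagElt ϖ m 0 = diagElt ϖ m 0 * ofK ϖ (elem31 r) := by
  refine ((represents_ofK _).mul (represents_diagElt _ _)).eq
    ((represents_diagElt _ _).mul (represents_ofK _)) ?_
  ext i j
  fin_cases i <;> fin_cases j <;>
    simp [diagMatrix, Matrix.mul_apply, Fin.sum_univ_three, hp]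
  field_simp

omit hp in
lemma diagElt_mul_cornerElt_zero (i j : ℕ) :
    diagElt ϖ (i + j) 0 * ofK ϖ (cornerElt 0) * diagElt ϖ j 0 =
      diagElt ϖ i j * ofK ϖ (cornerElt 0) := by
  refine (((represents_diagElt _ _).mul (represents_ofK _)).mul (represents_diagElt _ _)).eq
    ((represents_diagElt _ _).mul (represents_ofK _)) ?_
  ext i j
  fin_cases i <;> fin_cases j <;>
    simp [diagMatrix, Matrix.mul_apply, Fin.sum_univ_three]

/-- The corner entry of the product is `ϖ ^ (-(i + j + t))`, of largest absolute value; eliminating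
with it gives the Cartan decomposition. The left factor is close to 1, hence invisible to `τ` when
`i + t` is large. -/
lemma diagElt_mul_cornerElt_pow {i j t : ℕ} (ht : t ≤ j) :
    diagElt ϖ (i + j) 0 * ofK ϖ (cornerElt (p ^ (j - t))) * diagElt ϖ j 0 =
      ofK ϖ (elem21 (p ^ (i + t))) * diagElt ϖ (i + 2 * t) (j - t) *
        ofK ϖ (rotElt (p ^ t)) := by
  refine (((represents_diagElt _ _).mul (represents_ofK _)).mul (represents_diagElt _ _)).eq
    (((represents_ofK _).mul (represents_diagElt _ _)).mul (represents_ofK _)) ?_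
  obtain ⟨v, rfl⟩ := Nat.exists_eq_add_of_le ht
  have hv : t + v - t = v := by omega
  rw [hv]
  have h0 : (ϖ : F) ≠ 0 := ϖ.ne_zero
  ext a b
  fin_cases a <;> fin_cases b <;>
    simp [diagMatrix, Matrix.mul_apply, Fin.sum_univ_three, hp] <;>
    simp only [← zpow_natCast, ← zpow_neg, ← zpow_add₀ h0] <;> push_cast <;> ring_nf
end Matrices

/-! ### Matrix coefficients and the one-step estimate -/

section Coefficients

open ValuativeRel IsLocalRing

local notation "SL₃" R => Matrix.SpecialLinearGroup (Fin 3) R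

variable {F : Type*} [Field F] [ValuativeRel F]

/-- A matrix coefficient of a representation of `G'` of exponential growth at most `C + β m` on
`K D(m, 0) K`: it is given by a `K`-equivariant contraction `H : E → V` and a `K`-invariant vector
`ξ` in the unit ball. -/
structure IsCoefficientPair {ϖ : Fˣ} {V E : Type*} [NormedAddCommGroup V] [InnerProductSpace ℂ V]
    [NormedAddCommGroup E] [NormedSpace ℂ E] (τ : (SL₃ 𝒪[F]) →* (V ≃ₗᵢ[ℂ] V)) (C β : ℝ)
    (ρ : GPrime ϖ →* (E →L[ℂ] E)) (H : E →L[ℂ] V) (ξ : E) : Prop where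
  norm_le : ∀ k m k', ‖ρ (ofK ϖ k * diagElt ϖ m 0 * ofK ϖ k')‖ ≤ Real.exp (C + β * m)
  equivariant : ∀ k x, H (ρ (ofK ϖ k) x) = τ k (H x)
  invariant : ∀ k, ρ (ofK ϖ k) ξ = ξ
  norm_op_le : ‖H‖ ≤ 1
  norm_vec_le : ‖ξ‖ ≤ 1

variable {ϖ : Fˣ} {V E : Type*} [NormedAddCommGroup V] [InnerProductSpace ℂ V]
    [NormedAddCommGroup E] [NormedSpace ℂ E] {τ : (SL₃ 𝒪[F]) →* (V ≃ₗᵢ[ℂ] V)} {C β : ℝ}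
    {ρ : GPrime ϖ →* (E →L[ℂ] E)} {H : E →L[ℂ] V} {ξ : E}

lemma IsCoefficientPair.apply_mul (hc : IsCoefficientPair τ C β ρ H ξ) (k k' : SL₃ 𝒪[F])
    (g : GPrime ϖ) : H (ρ (ofK ϖ k * g * ofK ϖ k') ξ) = τ k (H (ρ g ξ)) := by
  rw [map_mul, map_mul, mul_apply_eq_comp, mul_apply_eq_comp,
    hc.invariant, hc.equivariant]

lemma IsCoefficientPair.apply_mul_right (hc : IsCoefficientPair τ C β ρ H ξ) (k' : SL₃ 𝒪[F])
    (g : GPrime ϖ) : H (ρ (g * ofK ϖ k') ξ) = H (ρ g ξ) := by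
  rw [map_mul, mul_apply_eq_comp, hc.invariant]

theorem IsCoefficientPair.norm_sub_le [TopologicalSpace F] [IsNonarchimedeanLocalField F]
    (hc : IsCoefficientPair τ C β ρ H ξ) {p : 𝒪[F]}
    (hp : Irreducible p) (hpϖ : (p : F) = ϖ) {h N : ℕ} (hh : 1 ≤ h)
    (hN : ∀ k ∈ congruenceSubgroup 𝒪[F] N, ∀ v, τ k v = v) {α : ℝ} (hα : 0 ≤ α)
    (hF : FourierNormLE (𝒪[F] ⧸ 𝓂[F] ^ h) E (Real.exp (-α))) {i j t : ℕ} (hit : N ≤ i + t)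
    (hj : h + t + N ≤ j) :
    ‖H (ρ (diagElt ϖ i j) ξ) - H (ρ (diagElt ϖ (i + 2 * t) (j - t)) ξ)‖ ≤
      2 * Nat.card (𝒪[F] ⧸ 𝓂[F] ^ (h + t)) * Real.exp (α * (h + t + N) / h) *
        (Real.exp (C + β * (i + j)) * Real.exp (C + β * j) * Real.exp (-(α * j / h))) := by
  set f : 𝒪[F] → V := fun z =>
    H (ρ (diagElt ϖ (i + j) 0 * ofK ϖ (cornerElt z) * diagElt ϖ j 0) ξ) with hf
  have h0 : f 0 = H (ρ (diagElt ϖ i j) ξ) := by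
    simp only [hf]
    rw [diagElt_mul_cornerElt_zero, hc.apply_mul_right]
  have h1 : f (p ^ (j - t)) = H (ρ (diagElt ϖ (i + 2 * t) (j - t)) ξ) := by
    simp only [hf]
    rw [diagElt_mul_cornerElt_pow hpϖ (by omega), hc.apply_mul]
    exact hN _ (elem21_mem_congruenceSubgroup
      ((mem_maximalIdeal_pow hp).2 (pow_dvd_pow p hit))) _
  rw [← h0, ← h1]
  refine norm_apply_zero_sub_apply_pow_le hp hh hj hα hF f ?_
    (fun a b => H.comp (ρ (diagElt ϖ (i + j) 0 * ofK ϖ (rowElt a b))))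
    (fun x y => ρ (ofK ϖ (colElt x y) * diagElt ϖ j 0) ξ) ?_ ?_ ?_
  · intro z r
    simp only [hf]
    rw [cornerElt_add, map_mul (ofK ϖ), ← mul_assoc, mul_assoc _ (ofK ϖ (elem31 _)),
      elem31_mul_diagElt hpϖ, ← mul_assoc, hc.apply_mul_right]
  · intro a b x y hx
    rw [ContinuousLinearMap.comp_apply, ← mul_apply_eq_comp, ← map_mul]
    have h2 : diagElt ϖ (i + j) 0 * ofK ϖ (rowElt a b) * (ofK ϖ (colElt x y) * diagElt ϖ j 0) =
        ofK ϖ (elem32 x) * (diagElt ϖ (i + j) 0 * ofK ϖ (cornerElt (y - a * x - b)) *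
          diagElt ϖ j 0) * ofK ϖ (elem32 (-a)) := by
      calc _ = diagElt ϖ (i + j) 0 * ofK ϖ (rowElt a b * colElt x y) * diagElt ϖ j 0 := by
            rw [map_mul]; simp only [mul_assoc]
        _ = (diagElt ϖ (i + j) 0 * ofK ϖ (elem32 x)) * ofK ϖ (cornerElt (y - a * x - b)) *
            (ofK ϖ (elem32 (-a)) * diagElt ϖ j 0) := by
            rw [rowElt_mul_colElt, map_mul, map_mul]; simp only [mul_assoc]
        _ = _ := by
            rw [commute_elem32_diagElt, ← commute_elem32_diagElt]; simp only [mul_assoc]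
    rw [h2, hc.apply_mul]
    exact hN _ (elem32_mem_congruenceSubgroup ((mem_maximalIdeal_pow hp).2 hx)) _
  · intro a b
    refine (ContinuousLinearMap.opNorm_comp_le _ _).trans ?_
    have := hc.norm_le 1 (i + j) (rowElt a b)
    rw [map_one, one_mul] at this
    push_cast at this
    calc _ ≤ 1 * Real.exp (C + β * (i + j)) := by gcongr; exact hc.norm_op_le
      _ = _ := one_mul _
  · intro x y _
    refine (ContinuousLinearMap.le_opNorm _ _).trans ?_
    have := hc.norm_le (colElt x y) j 1
    rw [map_one, mul_one] at this
    calc _ ≤ Real.exp (C + β * j) * 1 := by gcongr; exact hc.norm_vec_le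
      _ = _ := mul_one _

end Coefficients

/-! ### The inverse transpose -/

section Dual

open ValuativeRel IsLocalRing

local notation "SL₃" R => Matrix.SpecialLinearGroup (Fin 3) R

/-- The permutation matrix of `(1 3)`. -/
def antidiag (R : Type*) [CommRing R] : Matrix (Fin 3) (Fin 3) R := !![0, 0, 1; 0, 1, 0; 1, 0, 0]

lemma antidiag_mul_self (R : Type*) [CommRing R] : antidiag R * antidiag R = 1 := by
  ext i j
  fin_cases i <;> fin_cases j <;> simp [antidiag, Matrix.mul_apply, Fin.sum_univ_three]

lemma antidiag_mul_transpose_mul_antidiag_apply {R : Type*} [CommRing R]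
    (A : Matrix (Fin 3) (Fin 3) R) (a b : Fin 3) :
    (antidiag R * A.transpose * antidiag R) a b = A (Fin.rev b) (Fin.rev a) := by
  simp only [Matrix.mul_apply, Fin.sum_univ_three]
  fin_cases a <;> fin_cases b <;> simp [antidiag]

lemma det_antidiag (R : Type*) [CommRing R] : (antidiag R).det = -1 := by
  simp [antidiag, Matrix.det_fin_three]

/-- The automorphism `g ↦ J (g⁻¹)ᵀ J` of `GL₃`, where `J` is the permutation matrix of `(1 3)`. -/
def dualGL (R : Type*) [CommRing R] : GL (Fin 3) R →* GL (Fin 3) R where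
  toFun g :=
    { val := antidiag R * (g⁻¹ : GL (Fin 3) R).1.transpose * antidiag R
      inv := antidiag R * g.1.transpose * antidiag R
      val_inv := by
        rw [show antidiag R * (g⁻¹ : GL (Fin 3) R).1.transpose * antidiag R *
          (antidiag R * g.1.transpose * antidiag R) = antidiag R * ((g⁻¹ : GL (Fin 3) R).1.transpose
          * (antidiag R * antidiag R) * g.1.transpose) * antidiag R by simp only [mul_assoc],
          antidiag_mul_self, mul_one, ← Matrix.transpose_mul, Units.mul_inv,
          Matrix.transpose_one, mul_one, antidiag_mul_self]
      inv_val := by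
        rw [show antidiag R * g.1.transpose * antidiag R *
          (antidiag R * (g⁻¹ : GL (Fin 3) R).1.transpose * antidiag R) = antidiag R *
          (g.1.transpose * (antidiag R * antidiag R) * (g⁻¹ : GL (Fin 3) R).1.transpose) *
          antidiag R by simp only [mul_assoc],
          antidiag_mul_self, mul_one, ← Matrix.transpose_mul, Units.inv_mul,
          Matrix.transpose_one, mul_one, antidiag_mul_self] }
  map_one' := by
    ext1
    simp [antidiag_mul_self]
  map_mul' g g' := by
    ext1
    simp only [Units.val_mul, mul_inv_rev, Matrix.transpose_mul]
    rw [show antidiag R * (g⁻¹ : GL (Fin 3) R).1.transpose * antidiag R *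
      (antidiag R * (g'⁻¹ : GL (Fin 3) R).1.transpose * antidiag R) =
      antidiag R * ((g⁻¹ : GL (Fin 3) R).1.transpose * (antidiag R * antidiag R) *
      (g'⁻¹ : GL (Fin 3) R).1.transpose) * antidiag R by simp only [mul_assoc],
      antidiag_mul_self, mul_one]

lemma coe_dualGL {R : Type*} [CommRing R] (g : GL (Fin 3) R) :
    (dualGL R g : Matrix (Fin 3) (Fin 3) R) =
      antidiag R * (g⁻¹ : GL (Fin 3) R).1.transpose * antidiag R := rfl

/-- The automorphism `k ↦ J (k⁻¹)ᵀ J` of `SL₃`. -/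
def dualSL (R : Type*) [CommRing R] : (SL₃ R) →* SL₃ R where
  toFun k := ⟨antidiag R * (k⁻¹ : SL₃ R).1.transpose * antidiag R, by
    rw [Matrix.det_mul, Matrix.det_mul, Matrix.det_transpose, det_antidiag, (k⁻¹ : SL₃ R).2]
    ring⟩
  map_one' := by
    ext1
    simp [antidiag_mul_self]
  map_mul' k k' := by
    apply Subtype.ext
    change antidiag R * ((k * k')⁻¹ : SL₃ R).1.transpose * antidiag R =
      antidiag R * (k⁻¹ : SL₃ R).1.transpose * antidiag R *
      (antidiag R * (k'⁻¹ : SL₃ R).1.transpose * antidiag R)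
    rw [show antidiag R * (k⁻¹ : SL₃ R).1.transpose * antidiag R *
      (antidiag R * (k'⁻¹ : SL₃ R).1.transpose * antidiag R) =
      antidiag R * ((k⁻¹ : SL₃ R).1.transpose * (antidiag R * antidiag R) *
      (k'⁻¹ : SL₃ R).1.transpose) * antidiag R by simp only [mul_assoc],
      antidiag_mul_self, mul_one, ← Matrix.transpose_mul, mul_inv_rev]
    rfl

lemma dualSL_mem_congruenceSubgroup {R : Type*} [CommRing R] [IsLocalRing R] {n : ℕ} {k : SL₃ R}
    (hk : k ∈ congruenceSubgroup R n) : dualSL R k ∈ congruenceSubgroup R n := by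
  have hk' := mem_congruenceSubgroup.1 (inv_mem hk)
  rw [mem_congruenceSubgroup]
  intro a b
  rw [show (dualSL R k).1 a b = (k⁻¹ : SL₃ R).1 (Fin.rev b) (Fin.rev a) from
    antidiag_mul_transpose_mul_antidiag_apply _ a b]
  have h1 : (1 : Matrix (Fin 3) (Fin 3) R) a b =
      (1 : Matrix (Fin 3) (Fin 3) R) (Fin.rev b) (Fin.rev a) := by
    simp only [Matrix.one_apply, Fin.rev_inj, eq_comm]
  rw [h1]
  exact hk' _ _

lemma det_dualGL {R : Type*} [CommRing R] (g : GL (Fin 3) R) :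
    Matrix.GeneralLinearGroup.det (dualGL R g) = (Matrix.GeneralLinearGroup.det g)⁻¹ := by
  rw [← map_inv]
  ext1
  simp only [Matrix.GeneralLinearGroup.val_det_apply, coe_dualGL]
  rw [Matrix.det_mul, Matrix.det_mul, Matrix.det_transpose, det_antidiag]
  ring

variable {F : Type*} [Field F] (ϖ : Fˣ)

/-- The restriction of `dualGL` to the matrices with determinant in `ϖ ^ ℤ`. -/
def dualDetPow : detPow ϖ →* detPow ϖ :=
  ((dualGL F).comp (detPow ϖ).subtype).codRestrict (detPow ϖ) fun x => by
    change Matrix.GeneralLinearGroup.det (dualGL F x) ∈ Subgroup.zpowers ϖ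
    rw [det_dualGL]
    exact inv_mem x.2

lemma dualDetPow_scalarPow : dualDetPow ϖ (scalarPow ϖ) = (scalarPow ϖ)⁻¹ := by
  apply Subtype.ext
  apply Units.ext
  change antidiag F * (Matrix.GeneralLinearGroup.scalar (Fin 3) ϖ)⁻¹.1.transpose * antidiag F =
    (Matrix.GeneralLinearGroup.scalar (Fin 3) ϖ)⁻¹.1
  rw [← map_inv]
  ext i j
  fin_cases i <;> fin_cases j <;>
    simp [antidiag, Matrix.mul_apply, Fin.sum_univ_three, Matrix.GeneralLinearGroup.scalar]

/-- The automorphism of `G'` induced by `g ↦ J (g⁻¹)ᵀ J`. -/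
def dualGPrime : GPrime ϖ →* GPrime ϖ :=
  QuotientGroup.map _ _ (dualDetPow ϖ) (by
    rw [Subgroup.zpowers_le, Subgroup.mem_comap, dualDetPow_scalarPow]
    exact inv_mem (Subgroup.mem_zpowers _))

lemma dualGPrime_ofK [ValuativeRel F] (k : SL₃ 𝒪[F]) :
    dualGPrime ϖ (ofK ϖ k) = ofK ϖ (dualSL 𝒪[F] k) := by
  refine congrArg (QuotientGroup.mk : detPow ϖ → GPrime ϖ) (Subtype.ext (Units.ext ?_))
  change antidiag F * (Matrix.SpecialLinearGroup.mapGL F k)⁻¹.1.transpose * antidiag F =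
    (antidiag 𝒪[F] * (k⁻¹ : SL₃ 𝒪[F]).1.transpose * antidiag 𝒪[F]).map (algebraMap 𝒪[F] F)
  rw [← map_inv, Matrix.map_mul, Matrix.map_mul]
  have h1 : (antidiag 𝒪[F]).map (algebraMap 𝒪[F] F) = antidiag F := by
    ext i j
    fin_cases i <;> fin_cases j <;> simp [antidiag]
  rw [h1]
  rfl

variable {ϖ}

lemma Represents.smul {g : GPrime ϖ} {A : Matrix (Fin 3) (Fin 3) F} (h : Represents g A) (n : ℤ) :
    Represents g ((ϖ : F) ^ n • A) := by
  obtain ⟨x, rfl, rfl⟩ := h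
  refine ⟨x * scalarPow ϖ ^ n, QuotientGroup.mk_mul_of_mem x (Subgroup.zpow_mem_zpowers _ n), ?_⟩
  have h1 : ((scalarPow ϖ ^ n : detPow ϖ) : GL (Fin 3) F) =
      Matrix.GeneralLinearGroup.scalar (Fin 3) (ϖ ^ n) := by
    rw [map_zpow]; rfl
  have h2 : ((Matrix.GeneralLinearGroup.scalar (Fin 3) (ϖ ^ n) : GL (Fin 3) F) :
      Matrix (Fin 3) (Fin 3) F) = Matrix.diagonal fun _ => ((ϖ ^ n : Fˣ) : F) := rfl
  rw [Subgroup.coe_mul, h1, Units.val_mul, h2]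
  ext i j
  rw [Matrix.mul_diagonal, Matrix.smul_apply, smul_eq_mul, mul_comm, Units.val_zpow_eq_zpow_val]

lemma Represents.dual {g : GPrime ϖ} {A B : Matrix (Fin 3) (Fin 3) F} (h : Represents g A)
    (hAB : A * B = 1) :
    Represents (dualGPrime ϖ g) (antidiag F * B.transpose * antidiag F) := by
  obtain ⟨x, rfl, rfl⟩ := h
  refine ⟨dualDetPow ϖ x, rfl, ?_⟩
  change antidiag F * (x : GL (Fin 3) F)⁻¹.1.transpose * antidiag F = _
  rw [Units.inv_eq_of_mul_eq_one_right hAB]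

/-- Inverting and reversing the diagonal gives `diag(1, ϖ ^ j, ϖ ^ (i + j))`; rescaling by `ϖ ^ (-(i
+ j))` swaps the roles of `i` and `j`. -/
lemma dualGPrime_diagElt (i j : ℕ) : dualGPrime ϖ (diagElt ϖ i j) = diagElt ϖ j i := by
  have h0 : (ϖ : F) ≠ 0 := ϖ.ne_zero
  refine (((represents_diagElt i j).dual (B := Matrix.diagonal
    ![(ϖ : F) ^ ((i : ℤ) + j), (ϖ : F) ^ (j : ℤ), 1]) ?_).smul (-((i : ℤ) + j))).eq
    (represents_diagElt j i) ?_
  · rw [diagMatrix, Matrix.diagonal_mul_diagonal, ← Matrix.diagonal_one]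
    congr 1
    ext a
    fin_cases a <;> simp [h0]
    rw [← zpow_add₀ h0]
    simp
  · ext a b
    rw [Matrix.smul_apply, antidiag_mul_transpose_mul_antidiag_apply]
    fin_cases a <;> fin_cases b <;> simp [diagMatrix, Fin.rev]
    · rw [add_comm]
    · rw [← zpow_natCast, ← zpow_natCast, ← zpow_add₀ h0, ← zpow_neg]
      congr 1
      ring
    · rw [← zpow_add₀ h0, show -(j : ℤ) + -i + (i + j) = 0 by ring, zpow_zero]

end Dual

/-! ### Generation of `SL₃` of a local ring by two blocks -/

section Generation

local notation "SL₃" R => Matrix.SpecialLinearGroup (Fin 3) R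

variable {R : Type*} [CommRing R]

/-- The elementary matrix with entry `x` at the place `(1, 2)`. -/
def elem12 (x : R) : SL₃ R := ⟨!![1, x, 0; 0, 1, 0; 0, 0, 1], by simp [Matrix.det_fin_three]⟩

@[simp]
lemma coe_elem12 (x : R) :
    ((elem12 x : SL₃ R) : Matrix (Fin 3) (Fin 3) R) = !![1, x, 0; 0, 1, 0; 0, 0, 1] := rfl

/-- The elementary matrix with entry `x` at the place `(1, 3)`. -/
def elem13 (x : R) : SL₃ R := ⟨!![1, 0, x; 0, 1, 0; 0, 0, 1], by simp [Matrix.det_fin_three]⟩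

@[simp]
lemma coe_elem13 (x : R) :
    ((elem13 x : SL₃ R) : Matrix (Fin 3) (Fin 3) R) = !![1, 0, x; 0, 1, 0; 0, 0, 1] := rfl

/-- The elementary matrix with entry `x` at the place `(2, 3)`. -/
def elem23 (x : R) : SL₃ R := ⟨!![1, 0, 0; 0, 1, x; 0, 0, 1], by simp [Matrix.det_fin_three]⟩

@[simp]
lemma coe_elem23 (x : R) :
    ((elem23 x : SL₃ R) : Matrix (Fin 3) (Fin 3) R) = !![1, 0, 0; 0, 1, x; 0, 0, 1] := rfl

lemma elem13_eq (x : R) : elem13 x = elem12 x * elem23 1 * elem12 (-x) * elem23 (-1) := by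
  ext i j
  fin_cases i <;> fin_cases j <;> simp [Matrix.mul_apply, Fin.sum_univ_three]

lemma elem31_eq (x : R) : elem31 x = elem32 x * elem21 1 * elem32 (-x) * elem21 (-1) := by
  ext i j
  fin_cases i <;> fin_cases j <;> simp [Matrix.mul_apply, Fin.sum_univ_three]

/-- The matrices with blocks in `SL₂ × 1`. -/
def IsUpperBlock (k : SL₃ R) : Prop :=
  k 0 2 = 0 ∧ k 1 2 = 0 ∧ k 2 0 = 0 ∧ k 2 1 = 0 ∧ k 2 2 = 1

/-- The matrices with blocks in `1 × SL₂`. -/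
def IsLowerBlock (k : SL₃ R) : Prop :=
  k 0 0 = 1 ∧ k 0 1 = 0 ∧ k 0 2 = 0 ∧ k 1 0 = 0 ∧ k 2 0 = 0

/-- Gaussian elimination: commutators of block elements give the remaining elementary matrices. The
determinant expansion makes some entry of the first column a unit, so row operations produce corner
entry 1, and clearing the first row and column leaves a lower block. -/
theorem eq_top_of_isUpperBlock_of_isLowerBlock [IsLocalRing R] (S : Subgroup (SL₃ R))
    (hU : ∀ k, IsUpperBlock k → k ∈ S) (hL : ∀ k, IsLowerBlock k → k ∈ S) : S = ⊤ := by
  have h12 : ∀ x, elem12 x ∈ S := fun x => hU _ (by simp [IsUpperBlock])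
  have h21 : ∀ x, elem21 x ∈ S := fun x => hU _ (by simp [IsUpperBlock])
  have h23 : ∀ x, elem23 x ∈ S := fun x => hL _ (by simp [IsLowerBlock])
  have h32 : ∀ x, elem32 x ∈ S := fun x => hL _ (by simp [IsLowerBlock])
  have h13 : ∀ x, elem13 x ∈ S := fun x => by
    rw [elem13_eq]
    exact S.mul_mem (S.mul_mem (S.mul_mem (h12 _) (h23 _)) (h12 _)) (h23 _)
  have h31 : ∀ x, elem31 x ∈ S := fun x => by
    rw [elem31_eq]
    exact S.mul_mem (S.mul_mem (S.mul_mem (h32 _) (h21 _)) (h32 _)) (h21 _)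
  have hone : ∀ k : SL₃ R, k 0 0 = 1 → k ∈ S := by
    intro k hk
    have h1 : elem31 (-(k 2 0)) * elem21 (-(k 1 0)) * k * elem12 (-(k 0 1)) *
        elem13 (-(k 0 2)) ∈ S := by
      apply hL
      simp only [IsLowerBlock, Matrix.SpecialLinearGroup.coe_mul, Matrix.mul_apply,
        Fin.sum_univ_three]
      simp [hk]
    rwa [S.mul_mem_cancel_right (h13 _), S.mul_mem_cancel_right (h12 _),
      S.mul_mem_cancel_left (S.mul_mem (h31 _) (h21 _))] at h1
  have hmid : ∀ k : SL₃ R, IsUnit (k 1 0) → k ∈ S := by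
    intro k ⟨u, hu⟩
    have h1 : elem12 ((1 - k 0 0) * ↑u⁻¹) * k ∈ S := by
      apply hone
      simp [Matrix.mul_apply, Fin.sum_univ_three, ← hu]
    rwa [S.mul_mem_cancel_left (h12 _)] at h1
  rw [eq_top_iff]
  intro k _
  have hdet : k 0 0 * (k 1 1 * k 2 2 - k 1 2 * k 2 1) + (k 1 0 * (k 0 2 * k 2 1 - k 0 1 * k 2 2) +
      k 2 0 * (k 0 1 * k 1 2 - k 0 2 * k 1 1)) = 1 := by
    have h1 := k.2
    rw [Matrix.det_fin_three] at h1
    exact Eq.trans (by ring) h1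
  rcases IsLocalRing.isUnit_or_isUnit_of_add_one hdet with h1 | h1
  · obtain ⟨u, hu⟩ := isUnit_of_mul_isUnit_left h1
    have h2 : elem21 ((1 - k 1 0) * ↑u⁻¹) * k ∈ S := by
      apply hmid
      simp [Matrix.mul_apply, Fin.sum_univ_three, ← hu]
    rwa [S.mul_mem_cancel_left (h21 _)] at h2
  · rcases IsLocalRing.isUnit_or_isUnit_of_isUnit_add h1 with h1 | h1
    · exact hmid k (isUnit_of_mul_isUnit_left h1)
    · obtain ⟨u, hu⟩ := isUnit_of_mul_isUnit_left h1
      have h2 : elem13 ((1 - k 0 0) * ↑u⁻¹) * k ∈ S := by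
        apply hone
        simp [Matrix.mul_apply, Fin.sum_univ_three, ← hu]
      rwa [S.mul_mem_cancel_left (h13 _)] at h2

end Generation

/-! ### Irreducible unitary representations of `SL₃(𝒪)` factor through a finite level -/

section Level

open ValuativeRel IsLocalRing Filter

local notation "SL₃" R => Matrix.SpecialLinearGroup (Fin 3) R

variable {F : Type*} [Field F] [ValuativeRel F] [TopologicalSpace F]
  [IsNonarchimedeanLocalField F]

lemma exists_maximalIdeal_pow_subset {s : Set 𝒪[F]} (hs : s ∈ 𝓝 (0 : 𝒪[F])) :
    ∃ n, ∀ x ∈ 𝓂[F] ^ n, x ∈ s := by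
  obtain ⟨p, hp⟩ := IsDiscreteValuationRing.exists_irreducible 𝒪[F]
  rw [nhds_subtype_eq_comap, mem_comap] at hs
  obtain ⟨t, ht, hts⟩ := hs
  obtain ⟨γ, hγ, hγt⟩ := (IsValuativeTopology.hasBasis_nhds_zero' F).mem_iff.1 ht
  suffices h : ∃ n, ∀ x ∈ 𝓂[F] ^ n, valuation F (x : F) < γ by
    obtain ⟨n, hn⟩ := h
    exact ⟨n, fun x hx => hts (hγt (hn x hx))⟩
  obtain ⟨r, rfl⟩ := valuation_surjective γ
  have hr : r ≠ 0 := fun h => hγ (by rw [h, map_zero])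
  have hp1 : ∀ x ∈ 𝓂[F], valuation F (x : F) < 1 := by
    intro x hx
    rw [IsLocalRing.mem_maximalIdeal, mem_nonunits_iff] at hx
    exact Valuation.Integer.not_isUnit_iff_valuation_lt_one.1 hx
  by_cases hr1 : valuation F r ≤ 1
  · obtain ⟨n, u, hu⟩ := IsDiscreteValuationRing.eq_unit_mul_pow_irreducible
      (x := (⟨r, hr1⟩ : 𝒪[F])) (fun h => hr (congrArg Subtype.val h)) hp
    refine ⟨n + 1, fun x hx => ?_⟩
    obtain ⟨y, rfl⟩ := (mem_maximalIdeal_pow hp).1 hx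
    have h1 : (p ^ (n + 1) * y : 𝒪[F]) = ⟨r, hr1⟩ * (↑u⁻¹ * (p * y)) := by
      rw [hu, pow_succ]
      calc _ = (↑u * ↑u⁻¹ : 𝒪[F]) * (p ^ n * p * y) := by simp
        _ = _ := by ring
    rw [h1]
    have h2 := hp1 (↑u⁻¹ * (p * y)) (Ideal.mul_mem_left _ _ (Ideal.mul_mem_right _ _
      (hp.maximalIdeal_eq ▸ Ideal.mem_span_singleton_self p)))
    calc valuation F (r * ((↑u⁻¹ * (p * y) : 𝒪[F]) : F))
        = valuation F r * valuation F ((↑u⁻¹ * (p * y) : 𝒪[F]) : F) := map_mul _ _ _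
      _ < valuation F r := mul_lt_of_lt_one_right (zero_lt_iff.2 hγ) h2
  · exact ⟨1, fun x hx => (hp1 x (by simpa using hx)).trans (not_le.1 hr1)⟩

lemma exists_congruenceSubgroup_subset {s : Set (SL₃ 𝒪[F])} (hs : s ∈ 𝓝 (1 : SL₃ 𝒪[F])) :
    ∃ n, ∀ k ∈ congruenceSubgroup 𝒪[F] n, k ∈ s := by
  by_contra hcon
  push Not at hcon
  choose k hk hks using hcon
  have hlim : Tendsto k atTop (𝓝 1) := by
    refine (Topology.IsInducing.subtypeVal (Y := Matrix (Fin 3) (Fin 3) 𝒪[F])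
      (t := fun A => A.det = 1)).tendsto_nhds_iff.2 (tendsto_pi_nhds.2 ?_)
    refine fun a => tendsto_pi_nhds.2 fun b => ?_
    rw [← tendsto_sub_nhds_zero_iff]
    intro t ht
    obtain ⟨n, hn⟩ := exists_maximalIdeal_pow_subset ht
    refine mem_map.2 ?_
    filter_upwards [eventually_ge_atTop n] with m hm
    exact hn _ (Ideal.pow_le_pow_right hm (mem_congruenceSubgroup.1 (hk m) a b))
  obtain ⟨n, hn⟩ := (hlim.eventually hs).exists
  exact hks n hn

/-- An orthogonal representation moving `v` by at most half its norm has a nonzero fixed vector. -/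
lemma exists_fixed_vector {G V : Type*} [Group G] [NormedAddCommGroup V] [InnerProductSpace ℝ V]
    [CompleteSpace V] (T : G → V →ₗᵢ[ℝ] V)
    (hmul : ∀ g g' v, T (g * g') v = T g (T g' v)) (S : Subgroup G) {v : V} (hv : v ≠ 0)
    (hS : ∀ k ∈ S, ‖T k v - v‖ ≤ ‖v‖ / 2) : ∃ w ≠ 0, ∀ k ∈ S, T k w = w := by
  -- The point of smallest norm in the closed convex hull of the orbit is the fixed vector; the hull
  -- stays in a ball around `v` that avoids 0.
  set C : Set V := closure (convexHull ℝ ((fun k => T k v) '' S)) with hC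
  have hconv : Convex ℝ C := (convex_convexHull ℝ _).closure
  have hne : C.Nonempty :=
    ⟨T 1 v, subset_closure (subset_convexHull ℝ _ ⟨1, S.one_mem, rfl⟩)⟩
  obtain ⟨w, hwC, hw⟩ := exists_norm_eq_iInf_of_complete_convex hne
    isClosed_closure.isComplete hconv 0
  have hmin : ∀ x ∈ C, ‖w‖ ≤ ‖x‖ := by
    intro x hx
    rw [zero_sub, norm_neg] at hw
    rw [hw]
    refine (ciInf_le ⟨0, ?_⟩ (⟨x, hx⟩ : C)).trans (by simp)
    rintro _ ⟨y, rfl⟩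
    exact norm_nonneg _
  have hball : C ⊆ Metric.closedBall v (‖v‖ / 2) := by
    refine closure_minimal (convexHull_min ?_ (convex_closedBall _ _)) Metric.isClosed_closedBall
    rintro _ ⟨k, hk, rfl⟩
    rw [mem_closedBall_iff_norm]
    exact hS k hk
  refine ⟨w, ?_, fun k hk => ?_⟩
  · rintro rfl
    have := hball hwC
    rw [mem_closedBall_iff_norm, zero_sub, norm_neg] at this
    have := norm_pos_iff.2 hv
    linarith
  · have hkw : T k w ∈ C := by
      have hmaps : Set.MapsTo (T k) (convexHull ℝ ((fun k => T k v) '' S))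
          (convexHull ℝ ((fun k => T k v) '' S)) := by
        rw [Set.mapsTo_iff_image_subset]
        have h1 := LinearMap.image_convexHull (T k).toLinearMap ((fun k => T k v) '' S)
        refine h1.subset.trans (convexHull_mono ?_)
        rintro _ ⟨_, ⟨k', hk', rfl⟩, rfl⟩
        exact ⟨k * k', S.mul_mem hk hk', hmul _ _ _⟩
      exact hmaps.closure (T k).continuous hwC
    -- Both `w` and `T k w` have minimal norm, and so their midpoint cannot be shorter; the
    -- parallelogram law then makes them equal.
    have hmid : ‖w‖ ≤ ‖(1 / 2 : ℝ) • T k w + (1 / 2 : ℝ) • w‖ :=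
      hmin _ (hconv hkw hwC (by norm_num) (by norm_num) (by norm_num))
    rw [← smul_add, norm_smul] at hmid
    have hpar := parallelogram_law_with_norm ℝ (T k w) w
    rw [LinearIsometry.norm_map] at hpar
    have h2 : 2 * ‖w‖ ≤ ‖T k w + w‖ := by
      norm_num at hmid
      linarith
    have h3 : ‖T k w - w‖ * ‖T k w - w‖ ≤ 0 := by nlinarith [norm_nonneg w]
    have h4 : ‖T k w - w‖ = 0 := mul_self_eq_zero.1 (le_antisymm h3 (mul_self_nonneg _))
    exact sub_eq_zero.1 (norm_eq_zero.1 h4)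

/-- The vectors fixed by a subgroup under a unitary representation. -/
def fixedSubmodule {G V : Type*} [Group G] [NormedAddCommGroup V] [InnerProductSpace ℂ V]
    (τ : G →* (V ≃ₗᵢ[ℂ] V)) (S : Subgroup G) : Submodule ℂ V where
  carrier := {v | ∀ k ∈ S, τ k v = v}
  add_mem' := fun ha hb k hk => by rw [map_add, ha k hk, hb k hk]
  zero_mem' := fun k _ => map_zero _
  smul_mem' := fun c x hx k hk => by rw [map_smul, hx k hk]

/-- Normality makes the fixed space stable under the whole group. Used both for a congruence
subgroup and for the whole group. -/
lemma fixedSubmodule_eq_bot_or_top {G V : Type*} [Group G] [TopologicalSpace G]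
    [NormedAddCommGroup V] [InnerProductSpace ℂ V] {τ : G →* (V ≃ₗᵢ[ℂ] V)}
    (hτ : IsIrreducibleUnitaryRep τ) (S : Subgroup G) [hS : S.Normal] :
    fixedSubmodule τ S = ⊥ ∨ fixedSubmodule τ S = ⊤ := by
  refine hτ.irreducible _ ?_ ?_
  · have : (fixedSubmodule τ S : Set V) = ⋂ k ∈ S, {v | τ k v = v} := by
      ext v
      simp [fixedSubmodule]
    rw [this]
    exact isClosed_biInter fun k _ => isClosed_eq (τ k).continuous continuous_id
  · intro g w hw k hk
    have h1 := hw (g⁻¹ * k * g) (by simpa using hS.conj_mem k hk g⁻¹)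
    have h2 : k * g = g * (g⁻¹ * k * g) := by group
    calc τ k (τ g w) = τ (k * g) w := by rw [map_mul]; rfl
      _ = τ g (τ (g⁻¹ * k * g) w) := by rw [h2, map_mul]; rfl
      _ = τ g w := by rw [h1]

/-- By continuity a small congruence subgroup barely moves some nonzero `v`, so it fixes a nonzero
vector; being normal, it then fixes everything. -/
theorem exists_congruenceSubgroup_trivial {V : Type*} [NormedAddCommGroup V]
    [InnerProductSpace ℂ V] [CompleteSpace V] {τ : (SL₃ 𝒪[F]) →* (V ≃ₗᵢ[ℂ] V)}
    (hτ : IsIrreducibleUnitaryRep τ) :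
    ∃ n, ∀ k ∈ congruenceSubgroup 𝒪[F] n, ∀ v, τ k v = v := by
  have := hτ.nontrivial
  obtain ⟨v, hv⟩ := exists_ne (0 : V)
  have hpos : 0 < ‖v‖ / 2 := half_pos (norm_pos_iff.2 hv)
  have hnhds : {k : SL₃ 𝒪[F] | ‖τ k v - v‖ < ‖v‖ / 2} ∈ 𝓝 (1 : SL₃ 𝒪[F]) := by
    refine (isOpen_lt ((hτ.continuous v).sub continuous_const).norm
      continuous_const).mem_nhds ?_
    simpa using hpos
  obtain ⟨n, hn⟩ := exists_congruenceSubgroup_subset hnhds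
  let : InnerProductSpace ℝ V := InnerProductSpace.rclikeToReal ℂ V
  obtain ⟨w, hw0, hw⟩ := exists_fixed_vector
    (fun k => ⟨(τ k).toLinearEquiv.toLinearMap.restrictScalars ℝ, (τ k).norm_map⟩)
    (fun g g' v => by rw [map_mul]; rfl) (congruenceSubgroup 𝒪[F] n) hv
    fun k hk => (hn k hk).le
  have : (congruenceSubgroup 𝒪[F] n).Normal := by
    rw [congruenceSubgroup]; infer_instance
  refine ⟨n, fun k hk v => ?_⟩
  rcases fixedSubmodule_eq_bot_or_top hτ (congruenceSubgroup 𝒪[F] n) with h | h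
  · exact absurd ((Submodule.mem_bot ℂ).1 (h ▸ (show w ∈ fixedSubmodule τ _ from hw))) hw0
  · exact (h ▸ Submodule.mem_top : v ∈ fixedSubmodule τ (congruenceSubgroup 𝒪[F] n)) k hk

end Level

/-! ### Invariant tensors as equivariant operators -/

section Tensor

variable {V E : Type*} [NormedAddCommGroup V] [InnerProductSpace ℂ V]
  [NormedAddCommGroup E] [NormedSpace ℂ E]

lemma toOperator_tensorAction {K : Type*} [Group K] (τ : K →* (V ≃ₗᵢ[ℂ] V))
    (ρ : K →* (E →L[ℂ] E)) (k : K) (η : V ⊗[ℂ] (StrongDual ℂ E)) (x : E) :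
    toOperator (tensorAction τ ρ k η) x = τ k (toOperator η (ρ k⁻¹ x)) := by
  induction η with
  | zero => simp
  | tmul v φ => simp [toOperator, tensorAction]
  | add a b ha hb => simp only [map_add, add_apply, ha, hb]

lemma toOperator_equivariant {K : Type*} [Group K] {τ : K →* (V ≃ₗᵢ[ℂ] V)}
    {ρ : K →* (E →L[ℂ] E)} {η : V ⊗[ℂ] (StrongDual ℂ E)} (hη : ∀ k, tensorAction τ ρ k η = η)
    (k : K) (x : E) : toOperator η (ρ k x) = τ k (toOperator η x) := by
  have h1 := toOperator_tensorAction τ ρ k η (ρ k x)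
  rw [hη, ← mul_apply_eq_comp (ρ k⁻¹), ← map_mul, inv_mul_cancel, map_one] at h1
  exact h1

end Tensor

/-! ### Convergence on the lattice `Λ` -/

section Convergence

variable {V : Type*} [NormedAddCommGroup V]

open Finset in
/-- Moving along a line `i + 2 j = 3 n` towards the diagonal. -/
theorem exists_norm_sub_diag_le (N h : ℕ) {A a β : ℝ} (hA : 0 ≤ A) (ha : 0 < a) (hβ : 0 ≤ β) :
    ∃ A' : ℝ, 0 ≤ A' ∧ ∀ (K : ℝ) (c : ℕ → ℕ → V), 0 ≤ K →
      (∀ i j, ‖c i j‖ ≤ K * Real.exp (β * (i + j))) →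
      (∀ i j t : ℕ, t = 1 ∨ t = N → N ≤ i + t → h + t + N ≤ j →
        ‖c i j - c (i + 2 * t) (j - t)‖ ≤ A * K * Real.exp (β * (i + 2 * j) - a * j)) →
      ∀ n i j : ℕ, i + 2 * j = 3 * n → n ≤ j + 1 →
        ‖c i j - c n n‖ ≤ A' * K * Real.exp ((3 * β - a) * n) := by
  set r := Real.exp (-a) with hr
  have hr0 : 0 ≤ r := (Real.exp_pos _).le
  have hr1 : r < 1 := Real.exp_zero ▸ Real.exp_lt_exp.2 (by linarith)
  -- Above this threshold all steps below are admissible; in particular, a jump by `N` from a point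
  -- with `i < N` still lands at `j - N ≥ n`. Below it the trivial bound suffices.
  set n₀ := 3 * N + h + 1 with hn₀
  have hG : 0 ≤ (1 - r)⁻¹ := inv_nonneg.2 (by linarith)
  refine ⟨2 * Real.exp (a * n₀) + A * (1 + (1 - r)⁻¹), by positivity, ?_⟩
  intro K c hK htriv hstep n i j hij hnj
  have hijR : (i : ℝ) + 2 * j = 3 * n := by exact_mod_cast hij
  set ε := Real.exp ((3 * β - a) * n) with hε
  have hε0 : 0 ≤ ε := (Real.exp_pos _).le
  rcases lt_or_ge n n₀ with hn | hn
  · have h1 : ∀ x : ℝ, x ≤ 3 * n → Real.exp (β * x) ≤ Real.exp (a * n₀) * ε := by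
      intro x hx
      rw [hε, ← Real.exp_add]
      apply Real.exp_le_exp.2
      have h2 : a * n ≤ a * n₀ := by
        have : (n : ℝ) ≤ n₀ := by exact_mod_cast hn.le
        gcongr
      have h3 : β * x ≤ β * (3 * n) := by gcongr
      linarith
    have h2 : ‖c i j - c n n‖ ≤ K * (Real.exp (a * n₀) * ε) + K * (Real.exp (a * n₀) * ε) := by
      refine (norm_sub_le _ _).trans (add_le_add ((htriv _ _).trans ?_) ((htriv _ _).trans ?_))
      · gcongr
        exact h1 _ (by linarith [(Nat.cast_nonneg j : (0 : ℝ) ≤ j)])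
      · gcongr
        exact h1 _ (by linarith [(Nat.cast_nonneg n : (0 : ℝ) ≤ n)])
    have h3 : 0 ≤ A * (1 + (1 - r)⁻¹) * K * ε := by positivity
    calc _ ≤ _ := h2
      _ ≤ K * (Real.exp (a * n₀) * ε) + K * (Real.exp (a * n₀) * ε) +
          A * (1 + (1 - r)⁻¹) * K * ε := le_add_of_nonneg_right h3
      _ = _ := by ring
  have hexp : ∀ i' d : ℕ, i' + 2 * (n + d) = 3 * n →
      Real.exp (β * (i' + 2 * (n + d : ℕ)) - a * (n + d : ℕ)) = ε * r ^ d := by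
    intro i' d h1
    have h2 : (i' : ℝ) + 2 * (n + d : ℕ) = 3 * n := by exact_mod_cast h1
    rw [h2, hε, hr, ← Real.exp_nat_mul, ← Real.exp_add]
    push_cast
    ring_nf
  have hind : ∀ d i' : ℕ, i' + 2 * (n + d) = 3 * n → N ≤ i' →
      ‖c i' (n + d) - c n n‖ ≤ A * K * ε * ∑ k ∈ range (d + 1), r ^ k := by
    intro d
    induction d with
    | zero =>
      intro i' h1 _
      obtain rfl : i' = n := by omega
      simp
      positivity
    | succ d ih =>
      intro i' h1 hi'
      have h2 := hstep i' (n + (d + 1)) 1 (Or.inl rfl) (by omega) (by omega)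
      rw [show n + (d + 1) - 1 = n + d by omega, hexp _ _ h1] at h2
      have h3 := ih (i' + 2 * 1) (by omega) (by omega)
      rw [Finset.sum_range_succ]
      calc _ = ‖(c i' (n + (d + 1)) - c (i' + 2 * 1) (n + d)) +
            (c (i' + 2 * 1) (n + d) - c n n)‖ := by rw [sub_add_sub_cancel]
        _ ≤ _ := (norm_add_le _ _).trans (add_le_add h2 h3)
        _ = _ := by ring
  have hgeom : ∀ d, ∑ k ∈ range (d + 1), r ^ k ≤ (1 - r)⁻¹ := by
    intro d
    rw [← tsum_geometric_of_lt_one hr0 hr1]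
    exact (summable_geometric_of_lt_one hr0 hr1).sum_le_tsum _ fun k _ => pow_nonneg hr0 k
  have hfar : ∀ i' j' : ℕ, i' + 2 * j' = 3 * n → n ≤ j' → N ≤ i' →
      ‖c i' j' - c n n‖ ≤ A * K * ε * (1 - r)⁻¹ := by
    intro i' j' h1 h2 h3
    obtain ⟨d, rfl⟩ := Nat.exists_eq_add_of_le h2
    refine (hind d i' h1 h3).trans ?_
    gcongr
    exact hgeom d
  have hsum : ‖c i j - c n n‖ ≤ A * K * ε + A * K * ε * (1 - r)⁻¹ := by
    have hp1 : 0 ≤ A * K * ε := by positivity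
    have hp2 : 0 ≤ A * K * ε * (1 - r)⁻¹ := by positivity
    rcases lt_or_ge j n with hj | hj
    -- The single point `(n + 2, n - 1)` beyond the diagonal is reached by one step from `(n, n)`;
    -- it serves to pass between consecutive lines.
    · obtain rfl : n = j + 1 := by omega
      obtain rfl : i = j + 1 + 2 * 1 := by omega
      have h2 := hstep (j + 1) (j + 1) 1 (Or.inl rfl) (by omega) (by omega)
      have h3 := hexp (j + 1) 0 (by omega)
      simp only [add_zero, pow_zero, mul_one] at h3
      rw [h3, Nat.add_sub_cancel] at h2
      rw [norm_sub_rev]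
      linarith
    · rcases lt_or_ge i N with hi | hi
      -- Near the wall, unit steps would leave a left factor not known to act trivially under `τ`;
      -- one jump of length `N` escapes this zone.
      · have h2 := hstep i j N (Or.inr rfl) (by omega) (by omega)
        have h3 := hfar (i + 2 * N) (j - N) (by omega) (by omega) (by omega)
        have h4 : Real.exp (β * (i + 2 * j) - a * j) ≤ ε := by
          obtain ⟨d, rfl⟩ := Nat.exists_eq_add_of_le hj
          rw [hexp i d hij]
          exact mul_le_of_le_one_right hε0 (pow_le_one₀ hr0 hr1.le)
        have h5 : A * K * Real.exp (β * (i + 2 * j) - a * j) ≤ A * K * ε := by gcongr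
        calc _ = ‖(c i j - c (i + 2 * N) (j - N)) + (c (i + 2 * N) (j - N) - c n n)‖ := by
              rw [sub_add_sub_cancel]
          _ ≤ _ := (norm_add_le _ _).trans (add_le_add (h2.trans h5) h3)
      · linarith [hfar i j hij hj hi]
  have h3 : 0 ≤ 2 * Real.exp (a * n₀) * K * ε := by positivity
  calc _ ≤ _ := hsum
    _ ≤ A * K * ε + A * K * ε * (1 - r)⁻¹ + 2 * Real.exp (a * n₀) * K * ε :=
        le_add_of_nonneg_right h3
    _ = _ := by ring

/-- A function on `Λ` which varies slowly along the lines `i + 2 j = 3 n` and `2 i + j = 3 n` has a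
limit at infinity, which is approached exponentially fast. -/
theorem exists_limit [CompleteSpace V] {A' K β γ : ℝ} (hA' : 0 ≤ A') (hK : 0 ≤ K) (hγ : 0 < γ)
    {c : ℕ → ℕ → V} (htriv : ∀ i j, ‖c i j‖ ≤ K * Real.exp (β * (i + j)))
    (hline : ∀ n i j : ℕ, i + 2 * j = 3 * n → n ≤ j + 1 →
      ‖c i j - c n n‖ ≤ A' * K * Real.exp (-(3 * γ) * n))
    (hline' : ∀ n i j : ℕ, 2 * i + j = 3 * n → n ≤ i + 1 →
      ‖c i j - c n n‖ ≤ A' * K * Real.exp (-(3 * γ) * n)) :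
    ∃ l : V, ∀ i j : ℕ, (i, j) ∈ Lam → ‖c i j - l‖ ≤
      (A' + (2 * A' + 1 + Real.exp (2 * β)) / (1 - Real.exp (-(3 * γ)))) * K *
        Real.exp (-γ * (i + j)) := by
  set r := Real.exp (-(3 * γ)) with hr
  have hr0 : 0 ≤ r := (Real.exp_pos _).le
  have hr1 : r < 1 := Real.exp_zero ▸ Real.exp_lt_exp.2 (by linarith)
  set B := 2 * A' + 1 + Real.exp (2 * β) with hB
  have hB0 : 0 ≤ B := by positivity
  have hpow : ∀ n : ℕ, Real.exp (-(3 * γ) * n) = r ^ n := fun n => by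
    rw [hr, ← Real.exp_nat_mul, mul_comm]
  have hstep : ∀ n, dist (c n n) (c (n + 1) (n + 1)) ≤ B * K * r ^ n := by
    intro n
    rw [dist_eq_norm]
    rcases Nat.eq_zero_or_pos n with rfl | hn
    -- The connecting point `(n + 2, n - 1)` does not exist for `n = 0`; the trivial bound
    -- contributes `1 + exp (2β)` to `B`.
    · have h1 := htriv 0 0
      have h2 := htriv 1 1
      have h3 : β * (((1 : ℕ) : ℝ) + (1 : ℕ)) = 2 * β := by push_cast; ring
      have h4 : β * (((0 : ℕ) : ℝ) + (0 : ℕ)) = 0 := by push_cast; ring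
      rw [h3] at h2
      rw [h4, Real.exp_zero] at h1
      have h5 : 0 ≤ A' * K := by positivity
      calc _ ≤ _ := norm_sub_le _ _
        _ ≤ K * 1 + K * Real.exp (2 * β) + 2 * (A' * K) := by
          simp only [zero_add]
          linarith
        _ = _ := by rw [hB]; ring
    -- `(n + 2, n - 1)` lies both on `i + 2j = 3n` and on `2i + j = 3(n + 1)`, linking consecutive
    -- diagonal points.
    · have h1 := hline n (n + 2) (n - 1) (by omega) (by omega)
      have h2 := hline' (n + 1) (n + 2) (n - 1) (by omega) (by omega)
      rw [hpow] at h1 h2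
      have h3 : r ^ (n + 1) ≤ r ^ n := pow_le_pow_of_le_one hr0 hr1.le (Nat.le_succ n)
      have h4 : A' * K * r ^ (n + 1) ≤ A' * K * r ^ n := by gcongr
      rw [norm_sub_rev] at h1
      have h5 : 0 ≤ (1 + Real.exp (2 * β)) * K * r ^ n := by positivity
      calc _ = ‖(c n n - c (n + 2) (n - 1)) + (c (n + 2) (n - 1) - c (n + 1) (n + 1))‖ := by
            rw [sub_add_sub_cancel]
        _ ≤ A' * K * r ^ n + A' * K * r ^ n + (1 + Real.exp (2 * β)) * K * r ^ n := by
            linarith [norm_add_le (c n n - c (n + 2) (n - 1))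
              (c (n + 2) (n - 1) - c (n + 1) (n + 1))]
        _ = _ := by rw [hB]; ring
  obtain ⟨l, hl⟩ := cauchySeq_tendsto_of_complete (cauchySeq_of_le_geometric r _ hr1 hstep)
  refine ⟨l, fun i j hij => ?_⟩
  have hdiag : ∀ n, ‖c n n - l‖ ≤ B * K * r ^ n / (1 - r) := fun n => by
    rw [← dist_eq_norm]
    exact dist_le_of_le_geometric_of_tendsto r _ hr1 hstep hl n
  have hB1 : 0 ≤ B / (1 - r) := div_nonneg hB0 (by linarith)
  have hfin : ∀ n : ℕ, i + j ≤ 3 * n → ‖c i j - c n n‖ ≤ A' * K * r ^ n →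
      ‖c i j - l‖ ≤ (A' + B / (1 - r)) * K * Real.exp (-γ * (i + j)) := by
    intro n hn h1
    have h2 : r ^ n ≤ Real.exp (-γ * (i + j)) := by
      rw [← hpow]
      apply Real.exp_le_exp.2
      have h3 : (i : ℝ) + j ≤ 3 * n := by exact_mod_cast hn
      have h4 : γ * (i + j) ≤ γ * (3 * n) := by gcongr
      linarith
    calc _ = ‖(c i j - c n n) + (c n n - l)‖ := by rw [sub_add_sub_cancel]
      _ ≤ A' * K * r ^ n + B * K * r ^ n / (1 - r) :=
          (norm_add_le _ _).trans (add_le_add h1 (hdiag n))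
      _ = (A' + B / (1 - r)) * K * r ^ n := by ring
      _ ≤ _ := by gcongr
  have hdvd : (3 : ℤ) ∣ (i : ℤ) - j := hij
  rcases le_total i j with h | h
  · obtain ⟨n, hn⟩ : ∃ n, i + 2 * j = 3 * n := ⟨(i + 2 * j) / 3, by omega⟩
    exact hfin n (by omega) (hpow n ▸ hline n i j hn (by omega))
  · obtain ⟨n, hn⟩ : ∃ n, 2 * i + j = 3 * n := ⟨(2 * i + j) / 3, by omega⟩
    exact hfin n (by omega) (hpow n ▸ hline' n i j hn (by omega))

end Convergence

/-! ### Vanishing of the limit and uniform constants -/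

section Main

open ValuativeRel IsLocalRing Filter

local notation "SL₃" R => Matrix.SpecialLinearGroup (Fin 3) R

lemma tendsto_add_cofinite_Lam :
    Tendsto (fun p : Lam => p.1.1 + p.1.2) cofinite atTop := by
  rw [← Nat.cofinite_eq_atTop]
  refine Tendsto.cofinite_of_finite_preimage_singleton fun n => ?_
  refine Set.Finite.of_finite_image (f := Subtype.val) ?_ Subtype.val_injective.injOn
  refine (Finset.HasAntidiagonal.antidiagonal n).finite_toSet.subset ?_
  rintro _ ⟨p, hp, rfl⟩
  simpa using hp

variable {F : Type*} [Field F] [ValuativeRel F] {ϖ : Fˣ}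

lemma commute_upperBlock_diagElt {k : SL₃ 𝒪[F]} (hk : IsUpperBlock k) (j : ℕ) :
    ofK ϖ k * diagElt ϖ 0 j = diagElt ϖ 0 j * ofK ϖ k := by
  obtain ⟨h1, h2, h3, h4, h5⟩ := hk
  refine ((represents_ofK _).mul (represents_diagElt _ _)).eq
    ((represents_diagElt _ _).mul (represents_ofK _)) ?_
  ext a b
  rw [diagMatrix, Matrix.mul_diagonal, Matrix.diagonal_mul]
  fin_cases a <;> fin_cases b <;> simp [h1, h2, h3, h4, h5, mul_comm]

lemma commute_lowerBlock_diagElt {k : SL₃ 𝒪[F]} (hk : IsLowerBlock k) (i : ℕ) :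
    ofK ϖ k * diagElt ϖ i 0 = diagElt ϖ i 0 * ofK ϖ k := by
  obtain ⟨h1, h2, h3, h4, h5⟩ := hk
  refine ((represents_ofK _).mul (represents_diagElt _ _)).eq
    ((represents_diagElt _ _).mul (represents_ofK _)) ?_
  ext a b
  rw [diagMatrix, Matrix.mul_diagonal, Matrix.diagonal_mul]
  fin_cases a <;> fin_cases b <;> simp [h1, h2, h3, h4, h5, mul_comm]

lemma length_le (k k' : SL₃ 𝒪[F]) (i j : ℕ) :
    length ϖ (ofK ϖ k * diagElt ϖ i j * ofK ϖ k') ≤ i + j :=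
  Nat.sInf_le ⟨i, j, k, k', rfl, rfl⟩

variable {V E : Type*} [NormedAddCommGroup V] [InnerProductSpace ℂ V]
    [NormedAddCommGroup E] [NormedSpace ℂ E] {τ : (SL₃ 𝒪[F]) →* (V ≃ₗᵢ[ℂ] V)} {C β : ℝ}
    {ρ : GPrime ϖ →* (E →L[ℂ] E)} {H : E →L[ℂ] V} {ξ : E}

/-- A limit of the matrix coefficient along both walls of the Weyl chamber is fixed by `K`. -/
lemma IsCoefficientPair.limit_fixed (hc : IsCoefficientPair τ C β ρ H ξ) {l : V}
    (h₁ : Tendsto (fun n : ℕ => H (ρ (diagElt ϖ 0 (3 * n)) ξ)) atTop (𝓝 l))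
    (h₂ : Tendsto (fun n : ℕ => H (ρ (diagElt ϖ (3 * n) 0) ξ)) atTop (𝓝 l))
    [IsLocalRing 𝒪[F]] (k : SL₃ 𝒪[F]) : τ k l = l := by
  -- If `k` commutes with every `g n`, it moves from left to right and is absorbed by `ξ`, so `τ k`
  -- fixes every term of the sequence.
  have hfix : ∀ (k : SL₃ 𝒪[F]) (g : ℕ → GPrime ϖ),
      (∀ n, ofK ϖ k * g n = g n * ofK ϖ k) →
      Tendsto (fun n => H (ρ (g n) ξ)) atTop (𝓝 l) → τ k l = l := by
    intro k g hg hl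
    refine tendsto_nhds_unique (((τ k).continuous.tendsto l).comp hl) (hl.congr fun n => ?_)
    have h1 := hc.apply_mul k 1 (g n)
    rw [hg, map_one, mul_one, hc.apply_mul_right] at h1
    exact h1
  let S : Subgroup (SL₃ 𝒪[F]) :=
    { carrier := {k | τ k l = l}
      mul_mem' := fun {a b} ha hb => by
        change τ (a * b) l = l
        rw [map_mul]
        exact (congrArg (τ a) hb).trans ha
      one_mem' := by change τ 1 l = l; rw [map_one]; rfl
      inv_mem' := fun {a} ha => by
        change τ a⁻¹ l = l
        rw [map_inv]
        exact ((τ a).symm_apply_eq).2 (Eq.symm ha) }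
  have hS : S = ⊤ := eq_top_of_isUpperBlock_of_isLowerBlock S
    (fun k hk => hfix k _ (fun n => commute_upperBlock_diagElt hk _) h₁)
    (fun k hk => hfix k _ (fun n => commute_lowerBlock_diagElt hk _) h₂)
  exact (hS ▸ Subgroup.mem_top k : k ∈ S)

lemma IsCoefficientPair.norm_le_exp (hc : IsCoefficientPair τ C β ρ H ξ) (hC : 0 ≤ C)
    (hρ : ∀ i j, ‖ρ (diagElt ϖ i j)‖ ≤ Real.exp (C + β * (i + j))) (i j : ℕ) :
    ‖H (ρ (diagElt ϖ i j) ξ)‖ ≤ Real.exp (2 * C) * Real.exp (β * (i + j)) := by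
  calc ‖H (ρ (diagElt ϖ i j) ξ)‖ ≤ ‖H‖ * (‖ρ (diagElt ϖ i j)‖ * ‖ξ‖) :=
        (H.le_opNorm _).trans (by gcongr; exact ContinuousLinearMap.le_opNorm _ _)
    _ ≤ 1 * (Real.exp (C + β * (i + j)) * 1) := by
        gcongr
        · exact hc.norm_op_le
        · exact hρ i j
        · exact hc.norm_vec_le
    _ ≤ _ := by
        rw [one_mul, mul_one, ← Real.exp_add]
        apply Real.exp_le_exp.2
        linarith

/-- One step along a line `i + 2 j = 3 n`, with a constant which does not depend on the
representation. -/
theorem exists_norm_step_le [TopologicalSpace F] [IsNonarchimedeanLocalField F]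
    (hϖ : IsUniformizer ϖ) {h : ℕ} (hh : 1 ≤ h) {α : ℝ} (hα : 0 < α) (N : ℕ) :
    ∃ A : ℝ, 0 ≤ A ∧ ∀ {V E : Type*} [NormedAddCommGroup V] [InnerProductSpace ℂ V]
      [NormedAddCommGroup E] [NormedSpace ℂ E] {τ : (SL₃ 𝒪[F]) →* (V ≃ₗᵢ[ℂ] V)} {C β : ℝ}
      {ρ : GPrime ϖ →* (E →L[ℂ] E)} {H : E →L[ℂ] V} {ξ : E},
      IsCoefficientPair τ C β ρ H ξ → (∀ k ∈ congruenceSubgroup 𝒪[F] N, ∀ v, τ k v = v) →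
      FourierNormLE (𝒪[F] ⧸ 𝓂[F] ^ h) E (Real.exp (-α)) →
      ∀ i j t : ℕ, t = 1 ∨ t = N → N ≤ i + t → h + t + N ≤ j →
        ‖H (ρ (diagElt ϖ i j) ξ) - H (ρ (diagElt ϖ (i + 2 * t) (j - t)) ξ)‖ ≤
          A * Real.exp (2 * C) * Real.exp (β * (i + 2 * j) - α / h * j) := by
  obtain ⟨p, hp, hpϖ⟩ := hϖ
  let A : ℕ → ℝ := fun t =>
    2 * Nat.card (𝒪[F] ⧸ 𝓂[F] ^ (h + t)) * Real.exp (α * (h + t + N) / h)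
  have hA : ∀ t, 0 ≤ A t := fun t => by positivity
  refine ⟨A 1 + A N, add_nonneg (hA 1) (hA N), ?_⟩
  intro V E _ _ _ _ τ C β ρ H ξ hc hN hF i j t ht hit hj
  have hAt : A t ≤ A 1 + A N := by
    rcases ht with rfl | rfl
    · linarith [hA N]
    · linarith [hA 1]
  refine (hc.norm_sub_le hp hpϖ hh hN hα.le hF hit hj).trans ?_
  have h1 : Real.exp (C + β * (i + j)) * Real.exp (C + β * j) * Real.exp (-(α * j / h)) =
      Real.exp (2 * C) * Real.exp (β * (i + 2 * j) - α / h * j) := by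
    simp only [← Real.exp_add]
    congr 1
    ring
  rw [h1, mul_assoc (A 1 + A N)]
  exact mul_le_mul_of_nonneg_right hAt (by positivity)

end Main

end LiaoSL3

end

theorem proposition4p6
    {F : Type w} [Field F] [ValuativeRel F] [TopologicalSpace F] [IsNonarchimedeanLocalField F]
    (ϖ : Fˣ) (hϖ : IsUniformizer ϖ)
    (h : ℕ) (hh : 1 ≤ h) (α : ℝ) (hα : 0 < α)
    -- a class of Banach spaces
    (ℰ : ∀ (E : Type u) [NormedAddCommGroup E] [NormedSpace ℂ E] [CompleteSpace E], Prop)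
    (hℰ : ∀ (E : Type u) [NormedAddCommGroup E] [NormedSpace ℂ E] [CompleteSpace E],
      ℰ E → FourierNormLE (𝒪[F] ⧸ 𝓂[F] ^ h) E (Real.exp (-α)))
    (β : ℝ) (hβ₀ : 0 ≤ β) (hβ : β < α / (3 * h))
    {V : Type v} [NormedAddCommGroup V] [InnerProductSpace ℂ V] [CompleteSpace V]
    (τ : Matrix.SpecialLinearGroup (Fin 3) 𝒪[F] →* (V ≃ₗᵢ[ℂ] V))
    (hτ : IsIrreducibleUnitaryRep τ) (hτ_nontrivial : ∃ k v, τ k v ≠ v) :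
    ∃ C' : ℝ, 0 < C' ∧
      ∀ C : ℝ, 0 ≤ C →
      ∀ (E : Type u) [NormedAddCommGroup E] [NormedSpace ℂ E] [CompleteSpace E], ℰ E →
      ∀ π : GPrime ϖ →* (E →L[ℂ] E), IsContinuousRep π →
      (∀ g, ‖π g‖ ≤ Real.exp (C + β * length ϖ g)) →
      ∀ ξ : E, (∀ k, π (ofK ϖ k) ξ = ξ) → ‖ξ‖ = 1 →
      ∀ η : V ⊗[ℂ] (StrongDual ℂ E),
        (∀ k, tensorAction τ (π.comp (ofK ϖ)) k η = η) → tensorNorm η = 1 →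
        Filter.Tendsto (fun p : Lam => pairing η (π (diagElt ϖ p.1.1 p.1.2) ξ))
          Filter.cofinite (𝓝 0) ∧
        ∀ i j : ℕ, (i, j) ∈ Lam →
          ‖pairing η (π (diagElt ϖ i j) ξ)‖ ≤
            C' * Real.exp (2 * C - (α / (3 * h) - β) * ((i : ℝ) + j)) := by
  obtain ⟨N, hN⟩ := exists_congruenceSubgroup_trivial hτ
  obtain ⟨A, hA, hstep⟩ := exists_norm_step_le hϖ hh hα N
  have hh0 : (0 : ℝ) < h := by exact_mod_cast hh
  obtain ⟨A', hA', hline⟩ := exists_norm_sub_diag_le (V := V) N h hA (div_pos hα hh0) hβ₀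
  set γ := α / (3 * h) - β with hγ
  have hγ0 : 0 < γ := sub_pos.2 hβ
  have hγ' : 3 * β - α / h = -(3 * γ) := by rw [hγ]; field_simp; ring
  have hr : 0 < 1 - Real.exp (-(3 * γ)) :=
    sub_pos.2 (Real.exp_zero ▸ Real.exp_lt_exp.2 (by linarith))
  refine ⟨A' + (2 * A' + 1 + Real.exp (2 * β)) / (1 - Real.exp (-(3 * γ))), by positivity, ?_⟩
  intro C hC E _ _ _ hE π _ hπ ξ hξ hξ1 η hη hη1
  have hlen : ∀ k k' i j, ‖π (ofK ϖ k * diagElt ϖ i j * ofK ϖ k')‖ ≤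
      Real.exp (C + β * (i + j)) := by
    intro k k' i j
    refine (hπ _).trans (Real.exp_le_exp.2 ?_)
    -- Only the upper bound is needed, since `β ≥ 0`; uniqueness in the Cartan decomposition plays
    -- no role.
    have : (length ϖ (ofK ϖ k * diagElt ϖ i j * ofK ϖ k') : ℝ) ≤ i + j := by
      exact_mod_cast length_le k k' i j
    gcongr
  have hdiag : ∀ i j, ‖π (diagElt ϖ i j)‖ ≤ Real.exp (C + β * (i + j)) := by
    intro i j
    simpa using hlen 1 1 i j
  have hequi : ∀ k x, toOperator η (π (ofK ϖ k) x) = τ k (toOperator η x) :=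
    toOperator_equivariant (ρ := π.comp (ofK ϖ)) hη
  have hc : IsCoefficientPair τ C β π (toOperator η) ξ :=
    { norm_le := fun k m k' => by simpa using hlen k k' m 0
      equivariant := hequi
      invariant := hξ
      norm_op_le := le_of_eq hη1
      norm_vec_le := hξ1.le }
  -- Twisting by the inverse transpose gives the coefficient `(i, j) ↦ c j i`. The step estimate
  -- uses only the level of `τ`, which the twist preserves.
  have hc' : IsCoefficientPair (τ.comp (dualSL 𝒪[F])) C β (π.comp (dualGPrime ϖ))
      (toOperator η) ξ :=
    { norm_le := fun k m k' => by
        simpa [dualGPrime_ofK, dualGPrime_diagElt] using hlen (dualSL _ k) (dualSL _ k') 0 m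
      equivariant := fun k x => by
        simpa [dualGPrime_ofK] using hequi (dualSL _ k) x
      invariant := fun k => by simpa [dualGPrime_ofK] using hξ (dualSL _ k)
      norm_op_le := le_of_eq hη1
      norm_vec_le := hξ1.le }
  have hF := hℰ E hE
  set c : ℕ → ℕ → V := fun i j => toOperator η (π (diagElt ϖ i j) ξ) with hcdef
  have htriv : ∀ i j, ‖c i j‖ ≤ Real.exp (2 * C) * Real.exp (β * (i + j)) :=
    hc.norm_le_exp hC hdiag
  have hl₁ := hline (Real.exp (2 * C)) c (Real.exp_nonneg _) htriv (hstep hc hN hF)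
  have hl₂ := hline (Real.exp (2 * C)) (fun i j => c j i) (Real.exp_nonneg _)
    (fun i j => by rw [add_comm (i : ℝ)]; exact htriv j i) (by
      have := hstep hc' (fun k hk v => hN _ (dualSL_mem_congruenceSubgroup hk) v) hF
      simpa only [MonoidHom.comp_apply, dualGPrime_diagElt] using this)
  rw [hγ'] at hl₁ hl₂
  obtain ⟨l, hl⟩ := exists_limit hA' (Real.exp_nonneg _) hγ0 htriv hl₁
    (fun n i j hij hn => hl₂ n j i (by omega) hn)
  set B := A' + (2 * A' + 1 + Real.exp (2 * β)) / (1 - Real.exp (-(3 * γ)))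
  have hdecay : Filter.Tendsto (fun n : ℕ => B * Real.exp (2 * C) * Real.exp (-γ * n))
      Filter.atTop (𝓝 0) := by
    have h1 : Filter.Tendsto (fun n : ℕ => γ * (n : ℝ)) Filter.atTop Filter.atTop :=
      tendsto_natCast_atTop_atTop.const_mul_atTop hγ0
    have h2 := (Real.tendsto_exp_neg_atTop_nhds_zero.comp h1).const_mul (B * Real.exp (2 * C))
    simpa [Function.comp_def] using h2
  have h3n : Filter.Tendsto (fun n : ℕ => 3 * n) Filter.atTop Filter.atTop :=
    Filter.tendsto_id.const_mul_atTop' (by norm_num)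
  have hwall : ∀ x : ℕ → ℕ × ℕ, (∀ n, x n ∈ Lam) → (∀ n, (x n).1 + (x n).2 = 3 * n) →
      Filter.Tendsto (fun n => c (x n).1 (x n).2) Filter.atTop (𝓝 l) := by
    intro x hx hx'
    rw [tendsto_iff_norm_sub_tendsto_zero]
    refine squeeze_zero (fun _ => norm_nonneg _) (fun n => ?_) (hdecay.comp h3n)
    have h1 := hl _ _ (hx n)
    have h2 : ((x n).1 : ℝ) + (x n).2 = ((3 * n : ℕ) : ℝ) := by exact_mod_cast hx' n
    rw [h2] at h1
    exact h1
  have hfix : ∀ k, τ k l = l := hc.limit_fixed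
    (hwall (fun n => (0, 3 * n)) (fun n => by simp [Lam]) fun n => by simp)
    (hwall (fun n => (3 * n, 0)) (fun n => by simp [Lam]) fun n => by simp)
  have hl0 : l = 0 := by
    have hmem : l ∈ fixedSubmodule τ ⊤ := fun k _ => hfix k
    rcases fixedSubmodule_eq_bot_or_top hτ ⊤ with h1 | h1
    · exact (Submodule.mem_bot ℂ).1 (h1 ▸ hmem)
    · obtain ⟨k, v, hkv⟩ := hτ_nontrivial
      exact absurd ((h1 ▸ Submodule.mem_top : v ∈ fixedSubmodule τ ⊤) k trivial) hkv
  have hbound : ∀ i j : ℕ, (i, j) ∈ Lam →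
      ‖c i j‖ ≤ B * Real.exp (2 * C) * Real.exp (-γ * ((i + j : ℕ) : ℝ)) := by
    intro i j hij
    have h1 := hl i j hij
    rw [hl0, sub_zero] at h1
    exact_mod_cast h1
  refine ⟨?_, fun i j hij => ?_⟩
  · exact squeeze_zero_norm (fun p => hbound _ _ p.2) (hdecay.comp tendsto_add_cofinite_Lam)
  · refine (hbound i j hij).trans (le_of_eq ?_)
    rw [mul_assoc, ← Real.exp_add]
    push_cast
    ring_nf
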